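/- **Theorem 6.1.** Let $M$ be a compact smooth manifold without boundary of dimension $m\ge 2$, oriented by its atlas; let $\mathfrak g$ be a finite-dimensional real Lie algebra with a symmetric, nondegenerate, invariant bilinear form $\langle\ ,\ \rangle$; and let $A_0\in\Omega^1(M;\mathfrak g)$ be a flat connection on the trivial bundle, $dA_0+\tfrac12[A_0,A_0]=0$. *Fields.* Let $E$ be a supercommutative $\mathbb Z$-graded real algebra (the grading is called ghost number, $\mathrm{gh}$). For homogeneous $\alpha,\beta\in\Omega^*(M)\otimes\mathfrak g\otimes E$ put $|\alpha|=\deg\alpha+\mathrm{gh}\,\alpha$, $[\![\alpha;\beta]\!]=(-1)^{\mathrm{gh}\alpha\,\deg\beta}[\alpha,\beta]$ and $\langle\!\langle\alpha;\beta\rangle\!\rangle=(-1)^{\mathrm{gh}\alpha\,\deg\beta}\langle\alpha,\beta\rangle$, where $[\ ,\ ]$ and $\langle\ ,\ \rangle$ are extended by the wedge product and the product of $E$, without further signs. The fields are $\mathfrak g$-valued forms $c,a,B,\tau_k$ $(1\le k\le m-2)$ of form degrees $0,1,m-2,m-2-k$ and ghost numbers $1,0,0,k$, and for each field $\phi$ an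 antifield $\phi^+$ of form degree $m-\deg\phi$ and ghost number $-1-\mathrm{gh}\,\phi$. Put $A=A_0+a$, $$\mathsf B=\sum_{k=1}^{m-2}(-1)^{\frac{k(k-1)}2}\tau_k+B+(-1)^m a^++c^+,$$ $$\mathsf A=(-1)^{m+1}c+A+(-1)^mB^++\sum_{k=1}^{m-2}(-1)^{\frac{k(k-1)}2+m(k+1)}\tau_k^+,\qquad \mathsf a=\mathsf A-A_0 ,$$ so that $|\mathsf a|=1$ and $|\mathsf B|=m-2$, and $$\mathsf F_{\mathsf A}=d_{A_0}\mathsf a+\tfrac12[\![\mathsf a;\mathsf a]\!],\qquad S=\int_M\langle\!\langle \mathsf B;\mathsf F_{\mathsf A}\rangle\!\rangle .$$ *Antibrackets.* Functionals are functions of the fields, with values in $E$, defined for all $E$ and natural in $E$. The left and right functional derivatives with respect to $\mathsf a$ are the superforms, natural in $E$, with $$\tfrac{d}{dt}\Big|_{0}F(\mathsf a+t\rho,\mathsf B)=\int_M\Big\langle\!\!\Big\langle\rho;\frac{\overrightarrow\partial F}{\partial\mathsf a}\Big\rangle\!\!\Big\rangle=\int_M\Big\langle\!\!\Big\langle\frac{F\overleftarrow\partial}{\partial\mathsf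 a};\rho\Big\rangle\!\!\Big\rangle$$ for all test superforms $\rho$ of total degree $1$; those with respect to $\mathsf B$ are defined likewise, with $\rho$ of total degree $m-2$. The super BV antibracket is $$(\!(F,G)\!)=\int_M\Big\langle\!\!\Big\langle\frac{F\overleftarrow\partial}{\partial\mathsf B};\frac{\overrightarrow\partial G}{\partial\mathsf a}\Big\rangle\!\!\Big\rangle-(-1)^m\Big\langle\!\!\Big\langle\frac{F\overleftarrow\partial}{\partial\mathsf a};\frac{\overrightarrow\partial G}{\partial\mathsf B}\Big\rangle\!\!\Big\rangle .$$ The ordinary BV antibracket is $$(F,G)=\sum_{\phi\in\{c,a,B,\tau_1,\dots,\tau_{m-2}\}}\int_M\Big\langle\frac{F\overleftarrow\partial}{\partial\phi},\frac{\overrightarrow\partial G}{\partial\phi^+}\Big\rangle-(-1)^{(m+1)\deg\phi}\Big\langle\frac{F\overleftarrow\partial}{\partial\phi^+},\frac{\overrightarrow\partial G}{\partial\phi}\Big\rangle ,$$ with the functional derivatives with respect to the single fields and antifields defined in the same way through $\int_M\langle\ ,\ \rangle$ and test forms of the degree and ghost number of the field in question. *Claim.* All functional derivatives of $S$, with respect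 to the superfields as well as to the component fields, exist as smooth forms, and $S$ satisfies the classical master equation $$(\!(S,S)\!)=0,$$ and, as a functional of the component fields, the ordinary master equation $(S,S)=0$. -/

import Mathlib

open scoped Manifold ContDiff TensorProduct
open MeasureTheory

universe u v w

noncomputable section

namespace BFTheory

/-! ### Differential forms on a manifold without boundary -/

/-- The model space `ℝᵐ`. -/
abbrev Model (m : ℕ) : Type := EuclideanSpace ℝ (Fin m)

/-- Alternating `p`-linear forms on `ℝᵐ`. -/
abbrev Alt (m p : ℕ) : Type := Model m [⋀^Fin p]→L[ℝ] ℝ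

instance altFiniteDimensional (m p : ℕ) : FiniteDimensional ℝ (Alt m p) := by
  let F : Alt m p →ₗ[ℝ] MultilinearMap ℝ (fun _ : Fin p => Model m) ℝ :=
    { toFun := fun f => f.toMultilinearMap
      map_add' := fun _ _ => rfl
      map_smul' := fun _ _ => rfl }
  refine FiniteDimensional.of_injective F ?_
  intro f g h
  ext v
  exact congrArg (fun k : MultilinearMap ℝ (fun _ : Fin p => Model m) ℝ => k v) h

theorem continuous_domCoprod {m p q : ℕ} (f : Alt m p) (g : Alt m q) :
    Continuous fun v : Fin p ⊕ Fin q → Model m =>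
      LinearMap.mul' ℝ ℝ (f.toAlternatingMap.domCoprod g.toAlternatingMap v) := by
  simp only [AlternatingMap.domCoprod_apply, sum_apply, map_sum]
  refine continuous_finsetSum _ fun σ _ => ?_
  induction σ using Quotient.inductionOn' with
  | _ σ =>
    have hf : Continuous fun v : Fin p ⊕ Fin q → Model m => f fun i => v (σ (Sum.inl i)) :=
      f.cont.comp (continuous_pi fun i => continuous_apply _)
    have hg : Continuous fun v : Fin p ⊕ Fin q → Model m => g fun i => v (σ (Sum.inr i)) :=
      g.cont.comp (continuous_pi fun i => continuous_apply _)
    have := (hf.mul hg).const_smul (Equiv.Perm.sign σ : ℤ)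
    refine this.congr fun v => ?_
    rw [AlternatingMap.domCoprod.summand_mk'']
    rcases Int.units_eq_one_or (Equiv.Perm.sign σ) with h | h <;> rw [h] <;>
      simp [MultilinearMap.domDomCongr_apply, MultilinearMap.domCoprod_apply]

/-- The wedge product of alternating forms,
`(f ∧ g)(v₁, …, vₙ) = ∑ sign(σ) f(v_σ(1), …, v_σ(p)) g(v_σ(p+1), …, v_σ(n))`, the sum running over
the `(p, q)`-shuffles. -/
def altWedge {m p q n : ℕ} (h : p + q = n) (f : Alt m p) (g : Alt m q) : Alt m n :=
  let w : Model m [⋀^Fin n]→ₗ[ℝ] ℝ :=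
    ((LinearMap.mul' ℝ ℝ).compAlternatingMap
      (f.toAlternatingMap.domCoprod g.toAlternatingMap)).domDomCongr
        (finSumFinEquiv.trans (finCongr h))
  { w with cont := (continuous_domCoprod f g).comp (continuous_pi fun _ => continuous_apply _) }

theorem altWedge_apply {m p q n : ℕ} (h : p + q = n) (f : Alt m p) (g : Alt m q)
    (v : Fin n → Model m) :
    altWedge h f g v = LinearMap.mul' ℝ ℝ (f.toAlternatingMap.domCoprod g.toAlternatingMap
      (fun i => v (finSumFinEquiv.trans (finCongr h) i))) := rfl

/-- The wedge product as a bilinear map. -/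
def altWedgeBilin (m : ℕ) {p q n : ℕ} (h : p + q = n) :
    Alt m p →ₗ[ℝ] Alt m q →ₗ[ℝ] Alt m n :=
  LinearMap.mk₂ ℝ (altWedge h)
    (fun f f' g => by
      ext v
      simp only [altWedge_apply, ContinuousAlternatingMap.add_apply, ← AlternatingMap.domCoprod'_apply,
        ContinuousAlternatingMap.toAlternatingMap_add, TensorProduct.add_tmul, map_add,
        AlternatingMap.add_apply])
    (fun c f g => by
      ext v
      simp only [altWedge_apply, ContinuousAlternatingMap.smul_apply, ← AlternatingMap.domCoprod'_apply,
        ContinuousAlternatingMap.toAlternatingMap_smul, ← TensorProduct.smul_tmul', map_smul,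
        AlternatingMap.smul_apply])
    (fun f g g' => by
      ext v
      simp only [altWedge_apply, ContinuousAlternatingMap.add_apply, ← AlternatingMap.domCoprod'_apply,
        ContinuousAlternatingMap.toAlternatingMap_add, TensorProduct.tmul_add, map_add,
        AlternatingMap.add_apply])
    (fun c f g => by
      ext v
      simp only [altWedge_apply, ContinuousAlternatingMap.smul_apply, ← AlternatingMap.domCoprod'_apply,
        ContinuousAlternatingMap.toAlternatingMap_smul, TensorProduct.tmul_smul, map_smul,
        AlternatingMap.smul_apply])

theorem altWedge_compContinuousLinearMap {m p q n : ℕ} (h : p + q = n) (f : Alt m p) (g : Alt m q)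
    (L : Model m →L[ℝ] Model m) :
    (altWedge h f g).compContinuousLinearMap L =
      altWedge h (f.compContinuousLinearMap L) (g.compContinuousLinearMap L) := by
  ext v
  simp only [altWedge_apply, ContinuousAlternatingMap.compContinuousLinearMap_apply,
    AlternatingMap.domCoprod_apply, sum_apply]
  congr 1
  refine Finset.sum_congr rfl fun σ _ => ?_
  induction σ using Quotient.inductionOn'
  rfl

section Forms

variable {m : ℕ} {M : Type*} [TopologicalSpace M] [ChartedSpace (Model m) M]

variable (m M) in
/-- Smooth real `p`-forms on `M`. A form is given by its coordinate representatives `α e` in the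
charts `e` of the atlas: they are smooth on the target of the chart, and any two of them correspond
to each other under pullback along the transition map. (Outside the target of the chart, where it
carries no information, the representative is normalized to zero.) -/
def DForm (p : ℕ) : Submodule ℝ (atlas (Model m) M → Model m → Alt m p) where
  carrier := {α |
    (∀ e, ContDiffOn ℝ ∞ (α e) e.1.target) ∧
    (∀ e e' : atlas (Model m) M, ∀ y ∈ (e.1.symm.trans e'.1).source,
      α e y = (α e' (e'.1 (e.1.symm y))).compContinuousLinearMap
        (fderiv ℝ (fun z => e'.1 (e.1.symm z)) y)) ∧
    (∀ e, ∀ y ∉ e.1.target, α e y = 0)}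
  add_mem' := by
    rintro α β ⟨h1, h2, h3⟩ ⟨k1, k2, k3⟩
    refine ⟨fun e => (h1 e).add (k1 e), fun e e' y hy => ?_, fun e y hy => ?_⟩
    · simp only [Pi.add_apply, h2 e e' y hy, k2 e e' y hy]
      rfl
    · simp [h3 e y hy, k3 e y hy]
  zero_mem' := ⟨fun _ => contDiffOn_const, fun _ _ _ _ => rfl, fun _ _ _ => rfl⟩
  smul_mem' := by
    rintro c α ⟨h1, h2, h3⟩
    refine ⟨fun e => (h1 e).const_smul c, fun e e' y hy => ?_, fun e y hy => ?_⟩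
    · simp only [Pi.smul_apply, h2 e e' y hy]
      rfl
    · simp [h3 e y hy]

theorem transition_contDiffAt [IsManifold (𝓡 m) ∞ M] (e e' : atlas (Model m) M) {y : Model m}
    (hy : y ∈ (e.1.symm.trans e'.1).source) :
    ContDiffAt ℝ ∞ (fun z => e'.1 (e.1.symm z)) y := by
  have h := HasGroupoid.compatible (G := contDiffGroupoid ∞ (𝓡 m)) e.2 e'.2
  rw [contDiffGroupoid, mem_groupoid_of_pregroupoid] at h
  have h1 : ContDiffOn ℝ ∞ (fun z => e'.1 (e.1.symm z)) (e.1.symm.trans e'.1).source := by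
    have := h.1
    simpa [contDiffPregroupoid, Function.comp_def] using this
  exact h1.contDiffAt ((e.1.symm.trans e'.1).open_source.mem_nhds hy)

open Classical in
/-- The exterior derivative, computed in each chart. -/
def extd [IsManifold (𝓡 m) ∞ M] (p : ℕ) : DForm m M p →ₗ[ℝ] DForm m M (p + 1) where
  toFun α := ⟨fun e => e.1.target.indicator (extDeriv (α.1 e)), by
    refine ⟨fun e => ?_, fun e e' y hy => ?_, fun e y hy => Set.indicator_of_notMem hy _⟩
    · have h := (α.2.1 e).fderiv_of_isOpen (m := ∞) e.1.open_target (by simp)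
      have h' : ContDiffOn ℝ ∞ (extDeriv (α.1 e)) e.1.target :=
        ContDiff.comp_contDiffOn (g := fun L : Model m →L[ℝ] Alt m p =>
          ContinuousAlternatingMap.alternatizeUncurryFinCLM ℝ (Model m) ℝ (n := p) L)
          (ContinuousLinearMap.contDiff _) h
      exact h'.congr fun y hy => Set.indicator_of_mem hy _
    · have hy1 : y ∈ e.1.target := by
        have := hy; simp at this; exact this.1
      have hy2 : e'.1 (e.1.symm y) ∈ e'.1.target := by
        have := hy; simp at this; exact e'.1.map_source this.2
      beta_reduce
      rw [Set.indicator_of_mem hy1, Set.indicator_of_mem hy2]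
      rw [← extDeriv_pullback (r := ∞) _ (transition_contDiffAt e e' hy)
        (by simpa using (WithTop.coe_le_coe.2 le_top : ((2 : ℕ∞) : WithTop ℕ∞) ≤ ((⊤ : ℕ∞) : WithTop ℕ∞)))]
      · apply Filter.EventuallyEq.extDeriv_eq
        filter_upwards [(e.1.symm.trans e'.1).open_source.mem_nhds hy] with z hz
        exact α.2.2.1 e e' z hz
      · exact ((α.2.1 e').contDiffAt (e'.1.open_target.mem_nhds hy2)).differentiableAt (by simp)⟩
  map_add' α β := by
    ext e y : 3
    by_cases hy : y ∈ e.1.target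
    · have hd : ∀ ξ : DForm m M p, DifferentiableAt ℝ (ξ.1 e) y := fun ξ =>
        ((ξ.2.1 e).contDiffAt (e.1.open_target.mem_nhds hy)).differentiableAt (by simp)
      simpa [Set.indicator_of_mem hy] using extDeriv_add (hd α) (hd β)
    · simp [Set.indicator_of_notMem hy]
  map_smul' c α := by
    ext e y : 3
    by_cases hy : y ∈ e.1.target
    · simpa [Set.indicator_of_mem hy] using extDeriv_smul c (α.1 e)
    · simp [Set.indicator_of_notMem hy]

/-- The wedge product of differential forms. -/
def wedge {p q n : ℕ} (h : p + q = n) : DForm m M p →ₗ[ℝ] DForm m M q →ₗ[ℝ] DForm m M n :=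
  LinearMap.mk₂ ℝ
    (fun α β => ⟨fun e y => altWedgeBilin m h (α.1 e y) (β.1 e y), by
      refine ⟨fun e => ?_, fun e e' y hy => ?_, fun e y hy => ?_⟩
      · have := (altWedgeBilin m h).toContinuousBilinearMap.isBoundedBilinearMap.contDiff
          (n := ∞) |>.comp_contDiffOn ((α.2.1 e).prodMk (β.2.1 e))
        exact this
      · beta_reduce
        rw [α.2.2.1 e e' y hy, β.2.2.1 e e' y hy]
        exact (altWedge_compContinuousLinearMap h _ _ _).symm
      · beta_reduce
        rw [α.2.2.2 e y hy, map_zero, LinearMap.zero_apply]⟩)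
    (fun α α' β => by ext e y : 3; simp)
    (fun c α β => by ext e y : 3; simp)
    (fun α β β' => by ext e y : 3; simp)
    (fun c α β => by ext e y : 3; simp)

variable (m M) in
/-- The charts of the atlas of `M` are consistently oriented: all transition maps have positive
Jacobian determinant. Such an atlas is an orientation of `M`. -/
def OrientedAtlas : Prop :=
  ∀ e e' : atlas (Model m) M, ∀ y ∈ (e.1.symm.trans e'.1).source,
    0 < (fderiv ℝ (fun z => e'.1 (e.1.symm z)) y).det

variable (m M) in
/-- A smooth partition of unity on `M` subordinate to the cover by the preferred charts. -/
def partition [IsManifold (𝓡 m) ∞ M] [T2Space M] [CompactSpace M] :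
    SmoothPartitionOfUnity M (𝓡 m) M Set.univ :=
  Classical.choose (SmoothPartitionOfUnity.exists_isSubordinate_chartAt_source (𝓡 m) M)

theorem partition_isSubordinate [IsManifold (𝓡 m) ∞ M] [T2Space M] [CompactSpace M] :
    (partition m M).IsSubordinate fun x => (chartAt (Model m) x).source :=
  Classical.choose_spec (SmoothPartitionOfUnity.exists_isSubordinate_chartAt_source (𝓡 m) M)

/-- The coefficient of `dx¹ ∧ ⋯ ∧ dxᵐ` in the coordinate representative of `α` in the preferred
chart at `x`. -/
def topCoeff (α : DForm m M m) (x : M) (y : Model m) : ℝ :=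
  α.1 ⟨chartAt (Model m) x, chart_mem_atlas _ x⟩ y (fun i => EuclideanSpace.basisFun (Fin m) ℝ i)

/-- The contribution to `∫_M α` of the preferred chart at `x`: the Lebesgue integral, over the
target of the chart, of `ρₓ α` for the partition of unity `ρ`. -/
def chartIntegral [IsManifold (𝓡 m) ∞ M] [T2Space M] [CompactSpace M] (α : DForm m M m) (x : M) :
    ℝ :=
  ∫ y in (chartAt (Model m) x).target,
    partition m M x ((chartAt (Model m) x).symm y) * topCoeff α x y

theorem chartIntegrable [IsManifold (𝓡 m) ∞ M] [T2Space M] [CompactSpace M] (α : DForm m M m)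
    (x : M) :
    IntegrableOn (fun y => partition m M x ((chartAt (Model m) x).symm y) * topCoeff α x y)
      (chartAt (Model m) x).target := by
  set e := chartAt (Model m) x with he
  have hc : ContinuousOn (fun y => partition m M x (e.symm y) * topCoeff α x y) e.target := by
    refine ContinuousOn.mul ?_ ?_
    · exact (partition m M x).contMDiff.continuous.comp_continuousOn e.continuousOn_symm
    · have h1 := (α.2.1 ⟨e, chart_mem_atlas _ x⟩).continuousOn
      intro y hy
      exact ((ContinuousAlternatingMap.apply ℝ (Model m) ℝ
        (fun i => EuclideanSpace.basisFun (Fin m) ℝ i)).continuous.continuousAt).comp_continuousWithinAt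
          (h1 y hy)
  have hsub : tsupport (partition m M x) ⊆ e.source := partition_isSubordinate x
  set K := e '' tsupport (partition m M x) with hK
  have hKc : IsCompact K :=
    (isClosed_tsupport _).isCompact.image_of_continuousOn (e.continuousOn.mono hsub)
  have hKt : K ⊆ e.target := by
    rintro _ ⟨z, hz, rfl⟩
    exact e.map_source (hsub hz)
  have h1 : IntegrableOn (fun y => partition m M x (e.symm y) * topCoeff α x y) K :=
    (hc.mono hKt).integrableOn_compact hKc
  refine h1.of_forall_sdiff_eq_zero e.open_target.measurableSet ?_
  rintro y ⟨hy, hyK⟩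
  have : e.symm y ∉ tsupport (partition m M x) := fun hz =>
    hyK ⟨e.symm y, hz, e.right_inv hy⟩
  rw [image_eq_zero_of_notMem_tsupport this, zero_mul]

theorem chartIntegral_finite [IsManifold (𝓡 m) ∞ M] [T2Space M] [CompactSpace M]
    (α : DForm m M m) : Function.HasFiniteSupport (chartIntegral α) := by
  refine ((partition m M).locallyFinite.finite_nonempty_of_compact).subset ?_
  intro x hx
  by_contra hne
  apply hx
  have h0 : ∀ z, partition m M x z = 0 := by
    intro z
    by_contra hz
    exact hne ⟨z, hz⟩
  simp [chartIntegral, h0]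

/-- The integral of top-degree forms over the compact manifold `M`, oriented by its atlas:
`∫_M α = ∑ₓ ∫ ρₓ α` for a partition of unity `ρ` subordinate to the cover by preferred charts. -/
def integral [IsManifold (𝓡 m) ∞ M] [T2Space M] [CompactSpace M] : DForm m M m →ₗ[ℝ] ℝ where
  toFun α := ∑ᶠ x : M, chartIntegral α x
  map_add' α β := by
    rw [← finsum_add_distrib (chartIntegral_finite α) (chartIntegral_finite β)]
    refine finsum_congr fun x => ?_
    rw [chartIntegral, chartIntegral, chartIntegral,
      ← integral_add (chartIntegrable α x) (chartIntegrable β x)]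
    refine integral_congr_ae (Filter.Eventually.of_forall fun y => ?_)
    simp [topCoeff, mul_add]
  map_smul' c α := by
    simp only [RingHom.id_apply, smul_eq_mul]
    rw [mul_finsum]
    refine finsum_congr fun x => ?_
    rw [chartIntegral, chartIntegral, ← integral_const_mul]
    refine integral_congr_ae (Filter.Eventually.of_forall fun y => ?_)
    simp [topCoeff, mul_left_comm]

end Forms

/-! ### Graded coefficient algebras -/

/-- Supercommutative `ℤ`-graded real algebras, the grading being the ghost number. They serve as
coefficients: fields of nonzero ghost number are forms with coefficients in such an algebra. -/
structure SuperAlg where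
  /-- the underlying type -/
  carrier : Type u
  [ring : Ring carrier]
  [algebra : Algebra ℝ carrier]
  /-- the homogeneous components -/
  gr : ℤ → Submodule ℝ carrier
  [graded : GradedAlgebra gr]
  supercomm : ∀ (i j : ℤ), ∀ x ∈ gr i, ∀ y ∈ gr j, x * y = ((-1 : ℝ) ^ (i * j)) • (y * x)

namespace SuperAlg

instance : CoeSort SuperAlg.{u} (Type u) := ⟨SuperAlg.carrier⟩

attribute [instance] SuperAlg.ring SuperAlg.algebra SuperAlg.graded

/-- Morphisms of graded algebras. -/
structure Hom (E E' : SuperAlg.{u}) where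
  /-- the underlying algebra homomorphism -/
  toAlgHom : E →ₐ[ℝ] E'
  map_gr : ∀ (g : ℤ), ∀ x ∈ E.gr g, toAlgHom x ∈ E'.gr g

/-- The sign operator `e ↦ (-1)^(gh(e) · n) e`. -/
def ghostSign (E : SuperAlg.{u}) (n : ℕ) : E →ₗ[ℝ] E :=
  DirectSum.toModule ℝ ℤ E (fun g => ((-1 : ℝ) ^ (g * n)) • (E.gr g).subtype) ∘ₗ
    (DirectSum.decomposeLinearEquiv E.gr).toLinearMap

theorem ghostSign_of_mem (E : SuperAlg.{u}) (n : ℕ) {g : ℤ} {x : E} (hx : x ∈ E.gr g) :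
    E.ghostSign n x = ((-1 : ℝ) ^ (g * n)) • x := by
  have : DirectSum.decompose E.gr x = DirectSum.of (fun i => E.gr i) g ⟨x, hx⟩ :=
    DirectSum.decompose_of_mem _ hx
  simp only [ghostSign, LinearMap.comp_apply, LinearEquiv.coe_coe,
    DirectSum.decomposeLinearEquiv_apply, this]
  rw [← DirectSum.lof_eq_of ℝ, DirectSum.toModule_lof]
  rfl

end SuperAlg

/-! ### Superforms -/

section Superforms

variable (m : ℕ) (M : Type v) [TopologicalSpace M] [ChartedSpace (Model m) M]
variable (𝔤 : Type w) [LieRing 𝔤] [LieAlgebra ℝ 𝔤]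

/-- `Ω^p(M) ⊗ 𝔤 ⊗ E`: forms of degree `p` with values in `𝔤`, with coefficients in `E`. -/
abbrev SForm (E : SuperAlg.{u}) (p : ℕ) : Type (max u v w) := DForm m M p ⊗[ℝ] (𝔤 ⊗[ℝ] E)

/-- Superforms: sums of components of all form degrees. (Components of degree `> m` vanish
automatically.) -/
abbrev Superform (E : SuperAlg.{u}) : Type (max u v w) := ∀ p : ℕ, SForm m M 𝔤 E p

/-- The `𝔤`-valued `p`-forms of ghost number `g`. -/
def ghostPart (E : SuperAlg.{u}) (p : ℕ) (g : ℤ) : Submodule ℝ (SForm m M 𝔤 E p) :=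
  LinearMap.range (LinearMap.lTensor (DForm m M p) (LinearMap.lTensor 𝔤 (E.gr g).subtype))

/-- The superforms of total degree `k`: the component of form degree `p` has ghost number
`k - p`. -/
def TotDeg (E : SuperAlg.{u}) (k : ℤ) : Submodule ℝ (Superform m M 𝔤 E) :=
  Submodule.pi Set.univ fun p => ghostPart m M 𝔤 E p (k - p)

variable {m M 𝔤}

/-- The action of a morphism of coefficient algebras on forms. -/
def SForm.map {E E' : SuperAlg.{u}} (f : E.Hom E') (p : ℕ) :
    SForm m M 𝔤 E p →ₗ[ℝ] SForm m M 𝔤 E' p :=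
  LinearMap.lTensor (DForm m M p) (LinearMap.lTensor 𝔤 f.toAlgHom.toLinearMap)

/-- A form with values in `𝔤`, regarded as a form of ghost number zero. -/
def ofClassical (E : SuperAlg.{u}) (p : ℕ) : DForm m M p ⊗[ℝ] 𝔤 →ₗ[ℝ] SForm m M 𝔤 E p :=
  LinearMap.lTensor (DForm m M p) ((TensorProduct.mk ℝ 𝔤 E).flip 1)

/-- The operator `(-1)^(gh · n)` on forms. -/
def SForm.sign {E : SuperAlg.{u}} (n : ℕ) {p : ℕ} : SForm m M 𝔤 E p →ₗ[ℝ] SForm m M 𝔤 E p :=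
  LinearMap.lTensor (DForm m M p) (LinearMap.lTensor 𝔤 (E.ghostSign n))

/-- The Lie bracket of `𝔤` as a bilinear map. -/
def lieBilin (𝔤 : Type w) [LieRing 𝔤] [LieAlgebra ℝ 𝔤] : 𝔤 →ₗ[ℝ] 𝔤 →ₗ[ℝ] 𝔤 :=
  LinearMap.mk₂ ℝ (fun x y => ⁅x, y⁆) add_lie smul_lie lie_add (fun c x y => lie_smul c x y)

/-- The bracket `[ω ⊗ x ⊗ e, ω' ⊗ x' ⊗ e'] = (ω ∧ ω') ⊗ [x, x'] ⊗ e e'`. -/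
def SForm.bracket {E : SuperAlg.{u}} {p q n : ℕ} (h : p + q = n) :
    SForm m M 𝔤 E p →ₗ[ℝ] SForm m M 𝔤 E q →ₗ[ℝ] SForm m M 𝔤 E n :=
  TensorProduct.map₂ (wedge h) (TensorProduct.map₂ (lieBilin 𝔤) (LinearMap.mul ℝ E))

/-- The bracket of ordinary `𝔤`-valued forms, `[ω ⊗ x, ω' ⊗ x'] = (ω ∧ ω') ⊗ [x, x']`. -/
def classicalBracket {p q n : ℕ} (h : p + q = n) :
    DForm m M p ⊗[ℝ] 𝔤 →ₗ[ℝ] DForm m M q ⊗[ℝ] 𝔤 →ₗ[ℝ] DForm m M n ⊗[ℝ] 𝔤 :=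
  TensorProduct.map₂ (wedge h) (lieBilin 𝔤)

/-- The dot Lie bracket `⟦α; β⟧ = (-1)^(gh α · deg β) [α, β]` of superforms. -/
def dotBracket {E : SuperAlg.{u}} (α β : Superform m M 𝔤 E) : Superform m M 𝔤 E := fun n =>
  ∑ i : Fin (n + 1), SForm.bracket (p := i) (q := n - i) (by omega)
    (SForm.sign (n - i) (α i)) (β (n - i))

section Smooth

variable [IsManifold (𝓡 m) ∞ M]

/-- The exterior derivative of superforms, `d(ω ⊗ x ⊗ e) = dω ⊗ x ⊗ e`. -/
def superd {E : SuperAlg.{u}} (α : Superform m M 𝔤 E) : Superform m M 𝔤 E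
  | 0 => 0
  | p + 1 => LinearMap.rTensor _ (extd p) (α p)

/-- A connection one-form `A₀` on the trivial bundle is flat if `dA₀ + ½ [A₀, A₀] = 0`. -/
def IsFlat (A₀ : DForm m M 1 ⊗[ℝ] 𝔤) : Prop :=
  LinearMap.rTensor 𝔤 (extd 1) A₀ + (1 / 2 : ℝ) • classicalBracket (by norm_num) A₀ A₀ = 0

/-- A connection one-form as a superform concentrated in form degree one. -/
def connectionForm (E : SuperAlg.{u}) (A₀ : DForm m M 1 ⊗[ℝ] 𝔤) : Superform m M 𝔤 E :=
  Pi.single 1 (ofClassical E 1 A₀)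

/-- The covariant derivative `d_{A₀} α = dα + [A₀, α]`. -/
def covd {E : SuperAlg.{u}} (A₀ : DForm m M 1 ⊗[ℝ] 𝔤) (α : Superform m M 𝔤 E) :
    Superform m M 𝔤 E :=
  superd α + dotBracket (connectionForm E A₀) α

/-- The supercurvature `F_A = d_{A₀} a + ½ ⟦a; a⟧` of `A = A₀ + a`, for a flat `A₀`. -/
def superCurvature {E : SuperAlg.{u}} (A₀ : DForm m M 1 ⊗[ℝ] 𝔤) (a : Superform m M 𝔤 E) :
    Superform m M 𝔤 E :=
  covd A₀ a + (1 / 2 : ℝ) • dotBracket a a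

variable [T2Space M] [CompactSpace M]

/-- The pairing `∫_M ⟨α, β⟩` of forms of degrees `p` and `q`, with
`⟨ω ⊗ x ⊗ e, ω' ⊗ x' ⊗ e'⟩ = κ(x, x') (ω ∧ ω') ⊗ e e'`. It vanishes unless `p + q = m`. -/
def pairInt {E : SuperAlg.{u}} (κ : LinearMap.BilinForm ℝ 𝔤) {p q : ℕ} :
    SForm m M 𝔤 E p →ₗ[ℝ] SForm m M 𝔤 E q →ₗ[ℝ] E :=
  if h : p + q = m then
    (TensorProduct.map₂ (wedge h) (TensorProduct.map₂ κ (LinearMap.mul ℝ E))).compr₂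
      ((TensorProduct.lid ℝ E).toLinearMap ∘ₗ
        TensorProduct.map integral (TensorProduct.lid ℝ E).toLinearMap)
  else 0

/-- The pairing `∫_M ⟪α; β⟫` of superforms for the dot version
`⟪α; β⟫ = (-1)^(gh α · deg β) ⟨α, β⟩` of the bilinear form. -/
def superPairInt {E : SuperAlg.{u}} (κ : LinearMap.BilinForm ℝ 𝔤)
    (α β : Superform m M 𝔤 E) : E :=
  ∑ p ∈ Finset.range (m + 1), pairInt κ (SForm.sign (m - p) (α p)) (β (m - p))

end Smooth

end Superforms

/-! ### Functionals of the superfields -/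

section Functionals

variable (m : ℕ) (M : Type v) [TopologicalSpace M] [ChartedSpace (Model m) M]
variable (𝔤 : Type w) [LieRing 𝔤] [LieAlgebra ℝ 𝔤]

/-- The space of superfields `a` with coefficients in `E`: superforms of total degree `1`. -/
abbrev FieldsA (E : SuperAlg.{u}) : Type (max u v w) := TotDeg m M 𝔤 E 1

/-- The space of superfields `B` with coefficients in `E`: superforms of total degree `m - 2`. -/
abbrev FieldsB (E : SuperAlg.{u}) : Type (max u v w) := TotDeg m M 𝔤 E ((m : ℤ) - 2)

variable {m M 𝔤}

/-- The action of a morphism of coefficient algebras on superforms. -/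
def Superform.map {E E' : SuperAlg.{u}} (f : E.Hom E') (α : Superform m M 𝔤 E) :
    Superform m M 𝔤 E' := fun p => SForm.map f p (α p)

variable (m M 𝔤)

/-- Functionals of graded fields `(a, B)` of total degrees `1` and `m - 2`: functions of the fields
with coefficients in an arbitrary graded algebra `E`, with values in `E`, natural in `E`. -/
@[ext]
structure Functional where
  /-- the value of the functional at fields with coefficients in `E` -/
  toFun : ∀ E : SuperAlg.{u}, FieldsA m M 𝔤 E → FieldsB m M 𝔤 E → E
  natural : ∀ (E E' : SuperAlg.{u}) (f : E.Hom E')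
    (a : FieldsA m M 𝔤 E) (b : FieldsB m M 𝔤 E) (a' : FieldsA m M 𝔤 E') (b' : FieldsB m M 𝔤 E'),
    a'.1 = Superform.map f a.1 → b'.1 = Superform.map f b.1 →
      toFun E' a' b' = f.toAlgHom (toFun E a b)

/-- Functionals of the fields with values in superforms, such as functional derivatives. -/
structure FormFunctional where
  /-- the value of the functional at fields with coefficients in `E` -/
  toFun : ∀ E : SuperAlg.{u}, FieldsA m M 𝔤 E → FieldsB m M 𝔤 E → Superform m M 𝔤 E
  natural : ∀ (E E' : SuperAlg.{u}) (f : E.Hom E')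
    (a : FieldsA m M 𝔤 E) (b : FieldsB m M 𝔤 E) (a' : FieldsA m M 𝔤 E') (b' : FieldsB m M 𝔤 E'),
    a'.1 = Superform.map f a.1 → b'.1 = Superform.map f b.1 →
      toFun E' a' b' = Superform.map f (toFun E a b)

instance : Zero (Functional.{u} m M 𝔤) :=
  ⟨{ toFun := fun _ _ _ => 0, natural := fun _ _ f _ _ _ _ _ _ => (map_zero f.toAlgHom).symm }⟩

variable {m M 𝔤}

/-- `d/dt|₀ f(t) = v` for a function with values in a real vector space `X` without topology:
the derivative is taken after applying linear functionals. In finite dimensions this is the usual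
derivative. -/
def HasDerivAtZero {X : Type*} [AddCommGroup X] [Module ℝ X] (f : ℝ → X) (v : X) : Prop :=
  ∀ l : Module.Dual ℝ X, HasDerivAt (fun t => l (f t)) (l v) 0

/-- The sign `σ_{a_j}` with which the field of form degree `j` enters the superfield
`A = (-1)^(m+1) c + A + (-1)^m B⁺ + ∑_{k=1}^{m-2} (-1)^(k(k-1)/2 + m(k+1)) τₖ⁺`.
The fields of form degrees `0`, `1`, `2`, `k + 2` are `c`, `A`, `B⁺`, `τₖ⁺`. -/
def sigmaA (m : ℕ) : ℕ → ℝ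
  | 0 => (-1) ^ (m + 1)
  | 1 => 1
  | k + 2 => (-1) ^ (k * (k - 1) / 2 + m * (k + 1))

/-- The sign `σ_{B_j}` with which the field of form degree `j` enters the superfield
`B = ∑_{k=1}^{m-2} (-1)^(k(k-1)/2) τₖ + B + (-1)^m a⁺ + c⁺`.
The fields of form degrees `m`, `m - 1`, `m - 2`, `m - 2 - k` are `c⁺`, `a⁺`, `B`, `τₖ`. -/
def sigmaB (m j : ℕ) : ℝ :=
  if j = m then 1
  else if j + 1 = m then (-1) ^ m
  else (-1) ^ ((m - 2 - j) * (m - 2 - j - 1) / 2)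

/-- Multiplication of the components of a superform by scalars. -/
def rescale {E : SuperAlg.{u}} {k : ℤ} (s : ℕ → ℝ) (α : TotDeg m M 𝔤 E k) : TotDeg m M 𝔤 E k :=
  ⟨fun p => s p • α.1 p, fun p hp => Submodule.smul_mem _ _ (α.2 p hp)⟩

/-- A functional of the superfields `a = ∑ⱼ σ_{a_j} a_j` and `B = ∑ⱼ σ_{B_j} B_j`, regarded as a
functional of the component fields `a_j`, `B_j`. -/
def Functional.inComponents (F : Functional.{u} m M 𝔤) : Functional.{u} m M 𝔤 where
  toFun E a b := F.toFun E (rescale (sigmaA m) a) (rescale (sigmaB m) b)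
  natural E E' f a b a' b' ha hb := by
    apply F.natural
    · funext p
      simp [rescale, Superform.map, ha]
    · funext p
      simp [rescale, Superform.map, hb]

/-! ### Naturality in the coefficient algebra -/

theorem SuperAlg.Hom.ghostSign {E E' : SuperAlg.{u}} (f : E.Hom E') (n : ℕ) (x : E) :
    E'.ghostSign n (f.toAlgHom x) = f.toAlgHom (E.ghostSign n x) := by
  induction x using DirectSum.Decomposition.inductionOn E.gr with
  | zero => simp
  | @homogeneous i x =>
    rw [E.ghostSign_of_mem n x.2, E'.ghostSign_of_mem n (f.map_gr i x x.2), map_smul]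
  | add x y hx hy => simp only [map_add, hx, hy]

theorem SForm.map_sign {E E' : SuperAlg.{u}} (f : E.Hom E') (n : ℕ) {p : ℕ}
    (α : SForm m M 𝔤 E p) :
    SForm.sign n (SForm.map f p α) = SForm.map f p (SForm.sign n α) := by
  simp only [SForm.sign, SForm.map, ← LinearMap.comp_apply, ← LinearMap.lTensor_comp]
  congr 3
  ext x
  exact f.ghostSign n x

theorem SForm.map_bracket {E E' : SuperAlg.{u}} (f : E.Hom E') {p q n : ℕ} (h : p + q = n)
    (α : SForm m M 𝔤 E p) (β : SForm m M 𝔤 E q) :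
    SForm.bracket h (SForm.map f p α) (SForm.map f q β) =
      SForm.map f n (SForm.bracket h α β) := by
  induction α using TensorProduct.induction_on with
  | zero => simp
  | add _ _ h1 h2 => simp only [map_add, LinearMap.add_apply, h1, h2]
  | tmul μ u =>
    induction u using TensorProduct.induction_on with
    | zero => simp
    | add _ _ h1 h2 => simp only [TensorProduct.tmul_add, map_add, LinearMap.add_apply, h1, h2]
    | tmul x e =>
      induction β using TensorProduct.induction_on with
      | zero => simp
      | add _ _ h1 h2 => simp only [map_add, h1, h2]
      | tmul ν u =>
        induction u using TensorProduct.induction_on with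
        | zero => simp
        | add _ _ h1 h2 => simp only [TensorProduct.tmul_add, map_add, h1, h2]
        | tmul y e' => simp [SForm.bracket, SForm.map]

theorem Superform.map_dotBracket {E E' : SuperAlg.{u}} (f : E.Hom E') (α β : Superform m M 𝔤 E) :
    dotBracket (Superform.map f α) (Superform.map f β) = Superform.map f (dotBracket α β) := by
  funext n
  simp only [dotBracket, Superform.map, map_sum, SForm.map_sign, SForm.map_bracket]

theorem Superform.map_connectionForm {E E' : SuperAlg.{u}} (f : E.Hom E')
    (A₀ : DForm m M 1 ⊗[ℝ] 𝔤) :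
    Superform.map f (connectionForm E A₀) = connectionForm E' A₀ := by
  funext n
  by_cases hn : n = 1
  · subst hn
    simp only [Superform.map, connectionForm, Pi.single_eq_same, SForm.map, ofClassical,
      ← LinearMap.comp_apply, ← LinearMap.lTensor_comp]
    congr 2
    ext x
    simp
  · simp [Superform.map, connectionForm, Pi.single_eq_of_ne hn]

section Smooth

variable [IsManifold (𝓡 m) ∞ M]

theorem Superform.map_superd {E E' : SuperAlg.{u}} (f : E.Hom E') (α : Superform m M 𝔤 E) :
    superd (Superform.map f α) = Superform.map f (superd α) := by
  funext n
  cases n with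
  | zero => simp [superd, Superform.map]
  | succ p =>
    simp only [superd, Superform.map, SForm.map, ← LinearMap.comp_apply,
      LinearMap.rTensor_comp_lTensor, LinearMap.lTensor_comp_rTensor]

theorem Superform.map_superCurvature {E E' : SuperAlg.{u}} (f : E.Hom E')
    (A₀ : DForm m M 1 ⊗[ℝ] 𝔤) (a : Superform m M 𝔤 E) :
    superCurvature A₀ (Superform.map f a) = Superform.map f (superCurvature A₀ a) := by
  simp only [superCurvature, covd, Superform.map_superd, Superform.map_dotBracket,
    ← Superform.map_connectionForm f A₀]
  funext p
  simp [Superform.map]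

variable [T2Space M] [CompactSpace M]
variable (κ : LinearMap.BilinForm ℝ 𝔤)

/-! ### The super BV antibracket -/

/-- `D` is the right functional derivative of `F` with respect to the superfield `a`:
`d/dt|₀ F(a + t ρ, B) = ∫_M ⟪D; ρ⟫` for all super test forms `ρ`. -/
def HasRightDerivA (F : Functional.{u} m M 𝔤) (D : FormFunctional.{u} m M 𝔤) : Prop :=
  ∀ (E : SuperAlg.{u}) (a : FieldsA m M 𝔤 E) (b : FieldsB m M 𝔤 E) (ρ : FieldsA m M 𝔤 E),
    HasDerivAtZero (fun t : ℝ => F.toFun E (a + t • ρ) b) (superPairInt κ (D.toFun E a b) ρ.1)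

/-- `D` is the left functional derivative of `F` with respect to the superfield `a`. -/
def HasLeftDerivA (F : Functional.{u} m M 𝔤) (D : FormFunctional.{u} m M 𝔤) : Prop :=
  ∀ (E : SuperAlg.{u}) (a : FieldsA m M 𝔤 E) (b : FieldsB m M 𝔤 E) (ρ : FieldsA m M 𝔤 E),
    HasDerivAtZero (fun t : ℝ => F.toFun E (a + t • ρ) b) (superPairInt κ ρ.1 (D.toFun E a b))

/-- `D` is the right functional derivative of `F` with respect to the superfield `B`. -/
def HasRightDerivB (F : Functional.{u} m M 𝔤) (D : FormFunctional.{u} m M 𝔤) : Prop :=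
  ∀ (E : SuperAlg.{u}) (a : FieldsA m M 𝔤 E) (b : FieldsB m M 𝔤 E) (ρ : FieldsB m M 𝔤 E),
    HasDerivAtZero (fun t : ℝ => F.toFun E a (b + t • ρ)) (superPairInt κ (D.toFun E a b) ρ.1)

/-- `D` is the left functional derivative of `F` with respect to the superfield `B`. -/
def HasLeftDerivB (F : Functional.{u} m M 𝔤) (D : FormFunctional.{u} m M 𝔤) : Prop :=
  ∀ (E : SuperAlg.{u}) (a : FieldsA m M 𝔤 E) (b : FieldsB m M 𝔤 E) (ρ : FieldsB m M 𝔤 E),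
    HasDerivAtZero (fun t : ℝ => F.toFun E a (b + t • ρ)) (superPairInt κ ρ.1 (D.toFun E a b))

/-- `H` is the super BV antibracket of `F` and `G`: these have functional derivatives, and
`H = ∫_M ⟪F ∂/∂B; ∂/∂a G⟫ - (-1)^m ⟪F ∂/∂a; ∂/∂B G⟫`. (For nondegenerate `κ` and oriented `M`
functional derivatives are unique, since the test forms may have coefficients in any extension of
`E` by a further generator.) -/
def HasSuperBVBracket (F G H : Functional.{u} m M 𝔤) : Prop :=
  ∃ FrA FrB GlA GlB : FormFunctional.{u} m M 𝔤,
    HasRightDerivA κ F FrA ∧ HasRightDerivB κ F FrB ∧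
    HasLeftDerivA κ G GlA ∧ HasLeftDerivB κ G GlB ∧
    ∀ (E : SuperAlg.{u}) (a : FieldsA m M 𝔤 E) (b : FieldsB m M 𝔤 E),
      H.toFun E a b = superPairInt κ (FrB.toFun E a b) (GlA.toFun E a b) -
        (-1 : ℝ) ^ m • superPairInt κ (FrA.toFun E a b) (GlB.toFun E a b)

/-! ### The ordinary BV antibracket

Here a functional is regarded as a functional of component fields: the component `a_j` of form
degree `j` is `c`, `a`, `B⁺`, `τ₁⁺`, …, `τ_{m-2}⁺` for `j = 0, …, m`, and the component `B_j` is
`τ_{m-2}`, …, `τ₁`, `B`, `a⁺`, `c⁺` for `j = 0, …, m`. The antifield of the field `a_j` (`j = 0, 1`)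
is `B_{m-j}`, and the antifield of the field `B_j` (`j = 0, …, m-2`) is `a_{m-j}`. The functional
derivatives with respect to fields of form degree `j` are forms of degree `m - j`. -/

/-- `D` collects the right functional derivatives of `F` with respect to the fields `a_j`:
`d/dt|₀ F(a_j + t ρ_j) = ∫_M ⟨D_{m-j}, ρ_j⟩` for all test forms `ρ_j`. -/
def HasRightDerivsA (F : Functional.{u} m M 𝔤) (D : FormFunctional.{u} m M 𝔤) : Prop :=
  ∀ (E : SuperAlg.{u}) (a : FieldsA m M 𝔤 E) (b : FieldsB m M 𝔤 E),
    ∀ j ≤ m, ∀ ρ : FieldsA m M 𝔤 E, (∀ i ≠ j, ρ.1 i = 0) →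
      HasDerivAtZero (fun t : ℝ => F.toFun E (a + t • ρ) b)
        (pairInt κ (D.toFun E a b (m - j)) (ρ.1 j))

/-- `D` collects the left functional derivatives of `F` with respect to the fields `a_j`. -/
def HasLeftDerivsA (F : Functional.{u} m M 𝔤) (D : FormFunctional.{u} m M 𝔤) : Prop :=
  ∀ (E : SuperAlg.{u}) (a : FieldsA m M 𝔤 E) (b : FieldsB m M 𝔤 E),
    ∀ j ≤ m, ∀ ρ : FieldsA m M 𝔤 E, (∀ i ≠ j, ρ.1 i = 0) →
      HasDerivAtZero (fun t : ℝ => F.toFun E (a + t • ρ) b)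
        (pairInt κ (ρ.1 j) (D.toFun E a b (m - j)))

/-- `D` collects the right functional derivatives of `F` with respect to the fields `B_j`. -/
def HasRightDerivsB (F : Functional.{u} m M 𝔤) (D : FormFunctional.{u} m M 𝔤) : Prop :=
  ∀ (E : SuperAlg.{u}) (a : FieldsA m M 𝔤 E) (b : FieldsB m M 𝔤 E),
    ∀ j ≤ m, ∀ ρ : FieldsB m M 𝔤 E, (∀ i ≠ j, ρ.1 i = 0) →
      HasDerivAtZero (fun t : ℝ => F.toFun E a (b + t • ρ))
        (pairInt κ (D.toFun E a b (m - j)) (ρ.1 j))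

/-- `D` collects the left functional derivatives of `F` with respect to the fields `B_j`. -/
def HasLeftDerivsB (F : Functional.{u} m M 𝔤) (D : FormFunctional.{u} m M 𝔤) : Prop :=
  ∀ (E : SuperAlg.{u}) (a : FieldsA m M 𝔤 E) (b : FieldsB m M 𝔤 E),
    ∀ j ≤ m, ∀ ρ : FieldsB m M 𝔤 E, (∀ i ≠ j, ρ.1 i = 0) →
      HasDerivAtZero (fun t : ℝ => F.toFun E a (b + t • ρ))
        (pairInt κ (ρ.1 j) (D.toFun E a b (m - j)))

/-- `H` is the BV antibracket of the functionals `F` and `G` of the component fields: these have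
functional derivatives, and `H` is the sum over the fields `φ` (first `c`, `a`, then
`τ_{m-2}`, …, `τ₁`, `B`) of
`∫_M ⟨F ∂/∂φ, ∂/∂φ⁺ G⟩ - (-1)^((m+1) deg φ) ⟨F ∂/∂φ⁺, ∂/∂φ G⟩`. -/
def HasBVBracket (F G H : Functional.{u} m M 𝔤) : Prop :=
  ∃ FrA FrB GlA GlB : FormFunctional.{u} m M 𝔤,
    HasRightDerivsA κ F FrA ∧ HasRightDerivsB κ F FrB ∧
    HasLeftDerivsA κ G GlA ∧ HasLeftDerivsB κ G GlB ∧
    ∀ (E : SuperAlg.{u}) (a : FieldsA m M 𝔤 E) (b : FieldsB m M 𝔤 E),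
      H.toFun E a b =
        ∑ j ∈ Finset.range 2,
          (pairInt κ (FrA.toFun E a b (m - j)) (GlB.toFun E a b (m - (m - j))) -
            (-1 : ℝ) ^ ((m + 1) * j) •
              pairInt κ (FrB.toFun E a b (m - (m - j))) (GlA.toFun E a b (m - j))) +
        ∑ j ∈ Finset.range (m - 1),
          (pairInt κ (FrB.toFun E a b (m - j)) (GlA.toFun E a b (m - (m - j))) -
            (-1 : ℝ) ^ ((m + 1) * j) •
              pairInt κ (FrA.toFun E a b (m - (m - j))) (GlB.toFun E a b (m - j)))

/-! ### The BV action -/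

theorem SForm.map_pairInt {E E' : SuperAlg.{u}} (f : E.Hom E') {p q : ℕ}
    (α : SForm m M 𝔤 E p) (β : SForm m M 𝔤 E q) :
    pairInt κ (SForm.map f p α) (SForm.map f q β) = f.toAlgHom (pairInt κ α β) := by
  by_cases h : p + q = m
  · simp only [pairInt, dif_pos h]
    induction α using TensorProduct.induction_on with
    | zero => simp
    | add _ _ h1 h2 => simp only [map_add, LinearMap.add_apply, h1, h2]
    | tmul μ u =>
      induction u using TensorProduct.induction_on with
      | zero => simp
      | add _ _ h1 h2 => simp only [TensorProduct.tmul_add, map_add, LinearMap.add_apply, h1, h2]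
      | tmul x e =>
        induction β using TensorProduct.induction_on with
        | zero => simp
        | add _ _ h1 h2 => simp only [map_add, h1, h2]
        | tmul ν u =>
          induction u using TensorProduct.induction_on with
          | zero => simp
          | add _ _ h1 h2 => simp only [TensorProduct.tmul_add, map_add, h1, h2]
          | tmul y e' => simp [SForm.map]
  · simp [pairInt, dif_neg h]

theorem Superform.map_superPairInt {E E' : SuperAlg.{u}} (f : E.Hom E')
    (α β : Superform m M 𝔤 E) :
    superPairInt κ (Superform.map f α) (Superform.map f β) =
      f.toAlgHom (superPairInt κ α β) := by
  simp only [superPairInt, Superform.map, SForm.map_sign, SForm.map_pairInt, map_sum]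

/-- The BV action `S = ∫_M ⟪B; F_A⟫` of `BF` theory, as a functional of the superfields
`a = A - A₀` and `B`, for a flat background connection `A₀`. -/
def bfAction (A₀ : DForm m M 1 ⊗[ℝ] 𝔤) : Functional.{u} m M 𝔤 where
  toFun _ a b := superPairInt κ b.1 (superCurvature A₀ a.1)
  natural E E' f a b a' b' ha hb := by
    rw [ha, hb, Superform.map_superCurvature, Superform.map_superPairInt]

end Smooth

end Functionals

end BFTheory

end

/-!
The action of BF theory solves the master equation because its functional derivatives are the
supercurvature `F_A` and the covariant derivative `d_A B`, and these are orthogonal by the Bianchi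
identity.

In detail, put `A = A₀ + a`. Since `A₀` is flat, the supercurvature is `F_A = dA + ½ ⟦A; A⟧`
(`superCurvature_eq`). The superforms with `d` and `⟦ ; ⟧` satisfy the axioms of a differential
graded Lie algebra (`superd_superd`, `superd_dotBracket`, `dotBracket_comm`, `dotBracket_leibniz`),
and hence `d_A F_A = 0` (`bianchi`). The pairing `∫ ⟪ ; ⟫` is graded symmetric
(`superPairInt_comm`); the operator `d` is skew-adjoint with respect to it by Stokes' theorem
(`superPairInt_superd`), and the operator `⟦A; ·⟧` by the invariance of the form on `𝔤`
(`superPairInt_dotBracket`). So `d_A` is skew-adjoint (`superPairInt_superCovd`), and therefore: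

* the variation of `S = ∫ ⟪B; F_A⟫` along `B` has the left and right derivative `F_A`, and the
  variation `∫ ⟪B; d_A ρ⟫` along `a` has the left derivative `d_A B` and the right derivative
  `-(-1)^m d_A B` (`hasRightDerivA_bfAction` and its companions);
* `∫ ⟪F_A; d_A B⟫ = ± ∫ ⟪d_A F_A; B⟫ = 0` (`superPairInt_curvature_covd`).

The super antibracket `((S, S))` equals `2 ∫ ⟪F_A; d_A B⟫`, which vanishes. A derivative with
respect to a superfield determines, up to signs, the derivatives with respect to its components
(`HasRightDerivA.inComponents` and its companions). With the signs in the expansions of the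
superfields the summands of the ordinary antibracket `(S, S)` are exactly the terms of
`2 ∫ ⟪F_A; d_A B⟫` in the separate form degrees, and the same identity gives `(S, S) = 0`.

The underlying calculus of forms is reduced to multilinear algebra as follows. The wedge product of
two alternatizations is the alternatization of a tensor product, so that its associativity and
graded commutativity come from those of the tensor product (`altWedge_assoc`, `altWedge_comm`).
The exterior derivative of `f` is the sum of the wedge products of the coordinate covectors with the
partial derivatives of `f`, so that its Leibniz rule follows from the two properties of the wedge
product (`extDeriv_altWedge`). Stokes' theorem (`integral_extd_eq_zero`) is reduced by the partition
of unity to a form supported in one chart, and there to the vanishing of the integral of a partial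
derivative of a compactly supported function.
-/

noncomputable section

namespace BFTheory

/-! ### The algebra of alternating forms -/

section AltAlgebra

open MultilinearMap Equiv

/-- The tensor product of two scalar-valued multilinear forms, the first `p` arguments being fed to
`a` and the last `q` to `b`. -/
def mulTensor {V : Type*} [AddCommGroup V] [Module ℝ V] {p q n : ℕ} (h : p + q = n)
    (a : MultilinearMap ℝ (fun _ : Fin p => V) ℝ) (b : MultilinearMap ℝ (fun _ : Fin q => V) ℝ) :
    MultilinearMap ℝ (fun _ : Fin n => V) ℝ :=
  ((LinearMap.mul' ℝ ℝ).compMultilinearMap (a.domCoprod b)).domDomCongr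
    (finSumFinEquiv.trans (finCongr h))

section

variable {V : Type*} [AddCommGroup V] [Module ℝ V] {p q n : ℕ}

theorem mulTensor_apply (h : p + q = n)
    (a : MultilinearMap ℝ (fun _ : Fin p => V) ℝ) (b : MultilinearMap ℝ (fun _ : Fin q => V) ℝ)
    (v : Fin n → V) :
    mulTensor h a b v = a (fun i => v (Fin.cast h (Fin.castAdd q i))) *
      b (fun j => v (Fin.cast h (Fin.natAdd p j))) := by
  simp only [mulTensor, MultilinearMap.domDomCongr_apply, LinearMap.compMultilinearMap_apply,
    MultilinearMap.domCoprod_apply, LinearMap.mul'_apply]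
  rfl

theorem mulTensor_assoc {p q r s t n : ℕ} (h₁ : p + q = s) (h₂ : s + r = n)
    (h₃ : q + r = t) (h₄ : p + t = n) (a : MultilinearMap ℝ (fun _ : Fin p => V) ℝ)
    (b : MultilinearMap ℝ (fun _ : Fin q => V) ℝ) (c : MultilinearMap ℝ (fun _ : Fin r => V) ℝ) :
    mulTensor h₂ (mulTensor h₁ a b) c = mulTensor h₄ a (mulTensor h₃ b c) := by
  ext v
  simp only [mulTensor_apply, mul_assoc]
  congr 2
  congr 1
  funext j
  congr 1
  ext
  simp only [Fin.val_cast, Fin.val_natAdd]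
  omega

theorem alternatization_domDomCongr {ι ι' : Type*} [Fintype ι] [DecidableEq ι] [Fintype ι']
    [DecidableEq ι'] (e : ι ≃ ι') (a : MultilinearMap ℝ (fun _ : ι => V) ℝ) :
    alternatization (a.domDomCongr e) = (alternatization a).domDomCongr e := by
  ext v
  rw [alternatization_apply, AlternatingMap.domDomCongr_apply, alternatization_apply]
  refine Fintype.sum_equiv e.symm.permCongr _ _ fun σ => ?_
  rw [Perm.sign_permCongr]
  congr 1
  simp [MultilinearMap.domDomCongr_apply, Function.comp_def]

theorem alternatization_mulTensor (h : p + q = n)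
    (a : MultilinearMap ℝ (fun _ : Fin p => V) ℝ) (b : MultilinearMap ℝ (fun _ : Fin q => V) ℝ) :
    alternatization (mulTensor h a b) =
      ((LinearMap.mul' ℝ ℝ).compAlternatingMap
        ((alternatization a).domCoprod (alternatization b))).domDomCongr
        (finSumFinEquiv.trans (finCongr h)) := by
  rw [mulTensor, alternatization_domDomCongr, LinearMap.compMultilinearMap_alternatization,
    domCoprod_alternization]

/-- Every alternating form is an alternatization; this reduces identities between wedge products to
identities between tensor products. -/
theorem exists_eq_alternatization (f : V [⋀^Fin p]→ₗ[ℝ] ℝ) :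
    ∃ a : MultilinearMap ℝ (fun _ : Fin p => V) ℝ, f = alternatization a := by
  refine ⟨((p.factorial : ℝ)⁻¹ • f : V [⋀^Fin p]→ₗ[ℝ] ℝ), ?_⟩
  rw [AlternatingMap.coe_alternatization, Fintype.card_fin, ← Nat.cast_smul_eq_nsmul ℝ, smul_smul,
    mul_inv_cancel₀ (by positivity), one_smul]

/-- The permutation that interchanges the initial and the final block, of lengths `p` and `q`, is
`p`-fold rotation; its sign is `(-1) ^ (p * q)`. -/
theorem exists_blockSwap (h : p + q = n) (h' : q + p = n) :
    ∃ F : Perm (Fin n), (Perm.sign F : ℤ) = (-1) ^ (p * q) ∧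
      (∀ j, F (Fin.cast h' (Fin.castAdd p j)) = Fin.cast h (Fin.natAdd p j)) ∧
      (∀ i, F (Fin.cast h' (Fin.natAdd q i)) = Fin.cast h (Fin.castAdd q i)) := by
  cases n with
  | zero =>
    obtain rfl : p = 0 := by omega
    obtain rfl : q = 0 := by omega
    exact ⟨1, by simp, fun j => j.elim0, fun j => j.elim0⟩
  | succ k =>
    have hval : ∀ (l : ℕ) (x : Fin (k + 1)),
        (((finRotate (k + 1)) ^ l) x : ℕ) = (x + l) % (k + 1) := by
      intro l x
      induction l with
      | zero => simp [Nat.mod_eq_of_lt x.2]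
      | succ l ih =>
        rw [pow_succ', Perm.mul_apply, finRotate_apply, Fin.val_add, ih]
        simp [add_assoc]
    refine ⟨(finRotate (k + 1)) ^ p, ?_, fun j => ?_, fun i => ?_⟩
    · rw [map_pow, sign_finRotate]
      push_cast
      rw [← pow_mul]
      change (-1 : ℤ) ^ (k * p) = _
      have hk : Even (k * p + p * q) := by
        have h1 : (k + 1) * p = p * p + p * q := by rw [← h]; ring
        have h2 := Nat.even_mul_succ_self p
        have : k * p + p * q + (p * (p + 1)) = 2 * (k * p + p) := by
          have : k * p + p = p * p + p * q := by linarith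
          nlinarith
        have h3 : Even (k * p + p * q + p * (p + 1)) := ⟨k * p + p, by omega⟩
        exact (Nat.even_add.1 h3).2 h2
      rw [Nat.even_add] at hk
      rcases Nat.even_or_odd (k * p) with h1 | h1
      · rw [h1.neg_one_pow, (hk.1 h1).neg_one_pow]
      · rw [h1.neg_one_pow, Odd.neg_one_pow]
        rw [← Nat.not_even_iff_odd] at h1 ⊢
        tauto
    · ext
      rw [hval]
      simp only [Fin.val_cast, Fin.val_castAdd, Fin.val_natAdd]
      have := j.2
      rw [Nat.mod_eq_of_lt (by omega)]
      omega
    · ext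
      rw [hval]
      simp only [Fin.val_cast, Fin.val_castAdd, Fin.val_natAdd]
      have := i.2
      rw [show q + (i : ℕ) + p = i + (k + 1) by omega, Nat.add_mod_right,
        Nat.mod_eq_of_lt (by omega)]

theorem alternatization_mulTensor_comm (h : p + q = n) (h' : q + p = n)
    (a : MultilinearMap ℝ (fun _ : Fin p => V) ℝ) (b : MultilinearMap ℝ (fun _ : Fin q => V) ℝ) :
    alternatization (mulTensor h a b) = (-1 : ℝ) ^ (p * q) • alternatization (mulTensor h' b a) := by
  obtain ⟨F, hF, hL, hR⟩ := exists_blockSwap h h'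
  ext v
  rw [AlternatingMap.smul_apply, alternatization_apply, alternatization_apply, Finset.smul_sum]
  refine Fintype.sum_equiv (Equiv.mulRight F) _ _ fun σ => ?_
  rw [Equiv.coe_mulRight, Perm.sign_mul, MultilinearMap.domDomCongr_apply,
    MultilinearMap.domDomCongr_apply, mulTensor_apply, mulTensor_apply]
  simp only [Perm.mul_apply, hL, hR, Units.smul_def, zsmul_eq_mul, Units.val_mul, hF, smul_eq_mul]
  push_cast
  have : ((-1 : ℝ) ^ (p * q)) * (-1) ^ (p * q) = 1 := by
    rw [← mul_pow]; simp
  linear_combination (-((Perm.sign σ : ℤ) : ℝ) *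
    a (fun i => v (σ (Fin.cast h (Fin.castAdd q i)))) *
    b (fun j => v (σ (Fin.cast h (Fin.natAdd p j))))) * this

/-- Expansion of `l ∧ a`, for a linear form `l`, along the argument that is fed to `l`. -/
theorem alternatization_mulTensor_one (h : 1 + p = p + 1)
    (l : MultilinearMap ℝ (fun _ : Fin 1 => V) ℝ) (a : MultilinearMap ℝ (fun _ : Fin p => V) ℝ)
    (v : Fin (p + 1) → V) :
    alternatization (mulTensor h l a) v =
      ∑ i : Fin (p + 1), (-1 : ℝ) ^ (i : ℕ) *
        (l (fun _ => v i) * alternatization a (i.removeNth v)) := by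
  -- A permutation of `Fin (p + 1)` is determined by the image `i` of `0` and by the permutation of
  -- the remaining entries.
  let e : Fin (p + 1) × Perm (Fin p) → Perm (Fin (p + 1)) := fun x =>
    x.1.cycleRange.symm * Perm.decomposeFin.symm (0, x.2)
  have he0 : ∀ x, e x 0 = x.1 := fun x => by simp [e, Perm.mul_apply]
  have heS : ∀ x j, e x (Fin.succ j) = x.1.succAbove (x.2 j) := fun x j => by
    simp [e, Perm.mul_apply]
  have hinj : Function.Injective e := by
    rintro ⟨i, σ⟩ ⟨j, τ⟩ hij
    have h0 : i = j := (he0 (i, σ)).symm.trans ((congrArg (fun π => π 0) hij).trans (he0 (j, τ)))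
    subst h0
    refine Prod.ext rfl (Equiv.ext fun k => ?_)
    have := heS (i, σ) k
    rw [hij, heS] at this
    exact (Fin.succAbove_right_injective this).symm
  have hbij : Function.Bijective e := by
    refine (Fintype.bijective_iff_injective_and_card e).2 ⟨hinj, ?_⟩
    rw [Fintype.card_prod, Fintype.card_perm, Fintype.card_perm, Fintype.card_fin, Fintype.card_fin,
      Nat.factorial_succ]
  have hsign : ∀ x : Fin (p + 1) × Perm (Fin p),
      ((Perm.sign (e x) : ℤ) : ℝ) = (-1) ^ (x.1 : ℕ) * ((Perm.sign x.2 : ℤ) : ℝ) := fun x => by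
    simp [e, Perm.sign_mul, Perm.decomposeFin.symm_sign]
  rw [alternatization_apply, ← hbij.sum_comp, Fintype.sum_prod_type]
  refine Finset.sum_congr rfl fun i _ => ?_
  rw [alternatization_apply, Finset.mul_sum, Finset.mul_sum]
  refine Finset.sum_congr rfl fun σ _ => ?_
  rw [MultilinearMap.domDomCongr_apply, MultilinearMap.domDomCongr_apply, mulTensor_apply]
  have h0 : ∀ j : Fin 1, Fin.cast h (Fin.castAdd p j) = 0 := fun j => by
    ext; simp
  have hS : ∀ j : Fin p, Fin.cast h (Fin.natAdd 1 j) = j.succ := fun j => by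
    ext; simp
  simp only [h0, hS, he0, heS, Units.smul_def, zsmul_eq_mul, hsign, Fin.removeNth]
  ring

end

variable {m p q r n : ℕ}

theorem altWedge_eq_alternatization (h : p + q = n) {f : Alt m p} {g : Alt m q}
    {a : MultilinearMap ℝ (fun _ : Fin p => Model m) ℝ}
    {b : MultilinearMap ℝ (fun _ : Fin q => Model m) ℝ}
    (hf : f.toAlternatingMap = alternatization a) (hg : g.toAlternatingMap = alternatization b) :
    (altWedge h f g).toAlternatingMap = alternatization (mulTensor h a b) := by
  rw [alternatization_mulTensor, ← hf, ← hg]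
  rfl

theorem altWedge_assoc {s t : ℕ} (h₁ : p + q = s) (h₂ : s + r = n) (h₃ : q + r = t)
    (h₄ : p + t = n) (f : Alt m p) (g : Alt m q) (k : Alt m r) :
    altWedge h₂ (altWedge h₁ f g) k = altWedge h₄ f (altWedge h₃ g k) := by
  obtain ⟨a, ha⟩ := exists_eq_alternatization f.toAlternatingMap
  obtain ⟨b, hb⟩ := exists_eq_alternatization g.toAlternatingMap
  obtain ⟨c, hc⟩ := exists_eq_alternatization k.toAlternatingMap
  apply ContinuousAlternatingMap.toAlternatingMap_injective
  rw [altWedge_eq_alternatization h₂ (altWedge_eq_alternatization h₁ ha hb) hc,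
    altWedge_eq_alternatization h₄ ha (altWedge_eq_alternatization h₃ hb hc),
    mulTensor_assoc h₁ h₂ h₃ h₄]

theorem altWedge_comm (h : p + q = n) (h' : q + p = n) (f : Alt m p) (g : Alt m q) :
    altWedge h f g = (-1 : ℝ) ^ (p * q) • altWedge h' g f := by
  obtain ⟨a, ha⟩ := exists_eq_alternatization f.toAlternatingMap
  obtain ⟨b, hb⟩ := exists_eq_alternatization g.toAlternatingMap
  apply ContinuousAlternatingMap.toAlternatingMap_injective
  rw [ContinuousAlternatingMap.toAlternatingMap_smul, altWedge_eq_alternatization h ha hb,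
    altWedge_eq_alternatization h' hb ha, alternatization_mulTensor_comm h h']

/-- A covector, regarded as an alternating `1`-form. -/
def covector (l : Model m →L[ℝ] ℝ) : Alt m 1 :=
  ContinuousAlternatingMap.ofSubsingleton ℝ (Model m) ℝ (0 : Fin 1) l

/-- Antisymmetrization of `l ⊗ f` is the wedge product `l ∧ f`. -/
theorem alternatizeUncurryFin_smulRight (h : 1 + p = p + 1) (l : Model m →L[ℝ] ℝ) (f : Alt m p) :
    ContinuousAlternatingMap.alternatizeUncurryFin (l.smulRight f) =
      altWedge h (covector l) f := by
  obtain ⟨a, ha⟩ := exists_eq_alternatization f.toAlternatingMap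
  obtain ⟨b, hb⟩ := exists_eq_alternatization (covector l).toAlternatingMap
  ext v
  have h1 := congrArg (fun F => F v) (altWedge_eq_alternatization h hb ha)
  have h2 : ∀ x : Model m, l x = ∑ σ : Perm (Fin 1), Perm.sign σ • b.domDomCongr σ (fun _ => x) := by
    intro x
    rw [← alternatization_apply, ← hb]
    rfl
  change altWedge h (covector l) f v = _ at h1
  rw [h1, alternatization_mulTensor_one, ← ha, ContinuousAlternatingMap.alternatizeUncurryFin_apply]
  refine Finset.sum_congr rfl fun i _ => ?_
  rw [← Int.cast_smul_eq_zsmul ℝ]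
  simp [h2]

/-- A linear map into a space of forms is a sum of terms `l ⊗ f`. -/
theorem eq_sum_smulRight (L : Model m →L[ℝ] Alt m p) :
    L = ∑ i : Fin m, (EuclideanSpace.proj i : Model m →L[ℝ] ℝ).smulRight
      (L (EuclideanSpace.basisFun (Fin m) ℝ i)) := by
  ext1 x
  conv_lhs => rw [← (EuclideanSpace.basisFun (Fin m) ℝ).sum_repr x]
  simp [_root_.map_sum]

theorem alternatizeUncurryFin_eq_sum (h : 1 + p = p + 1) (L : Model m →L[ℝ] Alt m p) :
    ContinuousAlternatingMap.alternatizeUncurryFin L =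
      ∑ i : Fin m, altWedgeBilin m h (covector (EuclideanSpace.proj i))
        (L (EuclideanSpace.basisFun (Fin m) ℝ i)) := by
  conv_lhs => rw [eq_sum_smulRight L]
  rw [← ContinuousAlternatingMap.alternatizeUncurryFinCLM_apply, _root_.map_sum]
  exact Finset.sum_congr rfl fun i _ => alternatizeUncurryFin_smulRight h _ _

theorem altWedgeBilin_apply (h : p + q = n) (f : Alt m p) (g : Alt m q) :
    altWedgeBilin m h f g = altWedge h f g := rfl

/-- Alternatization commutes with the wedge product by a fixed form on the right. As maps into
forms are sums of terms `l ⊗ f`, this is associativity of the wedge product. -/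
theorem alternatizeUncurryFin_altWedge_left (h : p + q = n) (h' : p + 1 + q = n + 1)
    (L : Model m →L[ℝ] Alt m p) (g : Alt m q) (K : Model m →L[ℝ] Alt m n)
    (hK : ∀ x, K x = altWedge h (L x) g) :
    ContinuousAlternatingMap.alternatizeUncurryFin K =
      altWedge h' (ContinuousAlternatingMap.alternatizeUncurryFin L) g := by
  rw [alternatizeUncurryFin_eq_sum (add_comm 1 n), alternatizeUncurryFin_eq_sum (add_comm 1 p),
    ← altWedgeBilin_apply, _root_.map_sum, LinearMap.sum_apply]
  refine Finset.sum_congr rfl fun i _ => ?_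
  rw [hK]
  exact (altWedge_assoc (add_comm 1 p) h' h (add_comm 1 n) _ _ _).symm

/-- The sign is that of moving a covector past the `p`-form `f`. -/
theorem alternatizeUncurryFin_altWedge_right (h : p + q = n) (h' : p + (q + 1) = n + 1)
    (f : Alt m p) (L : Model m →L[ℝ] Alt m q) (K : Model m →L[ℝ] Alt m n)
    (hK : ∀ x, K x = altWedge h f (L x)) :
    ContinuousAlternatingMap.alternatizeUncurryFin K =
      (-1 : ℝ) ^ p • altWedge h' f (ContinuousAlternatingMap.alternatizeUncurryFin L) := by
  rw [alternatizeUncurryFin_eq_sum (add_comm 1 n), alternatizeUncurryFin_eq_sum (add_comm 1 q),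
    ← altWedgeBilin_apply, _root_.map_sum, Finset.smul_sum]
  refine Finset.sum_congr rfl fun i _ => ?_
  rw [hK]
  have h1 := altWedge_assoc (add_comm 1 p) (by omega) h (add_comm 1 n)
    (covector (EuclideanSpace.proj i)) f (L (EuclideanSpace.basisFun (Fin m) ℝ i))
  have h2 := altWedge_assoc (rfl : p + 1 = p + 1) (by omega) (add_comm 1 q) h'
    f (covector (EuclideanSpace.proj i)) (L (EuclideanSpace.basisFun (Fin m) ℝ i))
  simp only [altWedgeBilin_apply]
  rw [← h1, ← h2, altWedge_comm (add_comm 1 p) rfl, one_mul, ← altWedgeBilin_apply, map_smul,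
    LinearMap.smul_apply, altWedgeBilin_apply]

/-- The Leibniz rule for the exterior derivative in a chart. -/
theorem extDeriv_altWedge (h : p + q = n) (h₁ : p + 1 + q = n + 1) (h₂ : p + (q + 1) = n + 1)
    {f : Model m → Alt m p} {g : Model m → Alt m q} {y : Model m}
    (hf : DifferentiableAt ℝ f y) (hg : DifferentiableAt ℝ g y) :
    extDeriv (fun z => altWedge h (f z) (g z)) y =
      altWedge h₁ (extDeriv f y) (g y) + (-1 : ℝ) ^ p • altWedge h₂ (f y) (extDeriv g y) := by
  let B := (altWedgeBilin m h).toContinuousBilinearMap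
  have hd : HasFDerivAt (fun z => altWedge h (f z) (g z))
      (B.precompR (Model m) (f y) (fderiv ℝ g y) + B.precompL (Model m) (fderiv ℝ f y) (g y)) y :=
    B.hasFDerivAt_of_bilinear hf.hasFDerivAt hg.hasFDerivAt
  rw [extDeriv, hd.fderiv, ← ContinuousAlternatingMap.alternatizeUncurryFinCLM_apply, map_add]
  refine (add_comm _ _).trans ?_
  congr 1
  · exact alternatizeUncurryFin_altWedge_left h h₁ _ _ _ fun x => rfl
  · exact alternatizeUncurryFin_altWedge_right h h₂ _ _ _ fun x => rfl

end AltAlgebra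

/-! ### Calculus of differential forms -/

section FormCalculus

variable {m : ℕ} {M : Type*} [TopologicalSpace M] [ChartedSpace (Model m) M] {p q r n : ℕ}

/-- The local representatives of a form vanish outside the target of the chart, so that it suffices
to compare forms on the targets. -/
theorem DForm.ext_target {α β : DForm m M p} (h : ∀ e, ∀ y ∈ e.1.target, α.1 e y = β.1 e y) :
    α = β := by
  refine Subtype.ext (funext fun e => funext fun y => ?_)
  by_cases hy : y ∈ e.1.target
  · exact h e y hy
  · rw [α.2.2.2 e y hy, β.2.2.2 e y hy]

theorem wedge_val (h : p + q = n) (α : DForm m M p) (β : DForm m M q) (e : atlas (Model m) M)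
    (y : Model m) : (wedge h α β).1 e y = altWedge h (α.1 e y) (β.1 e y) := rfl

theorem wedge_assoc {s t : ℕ} (h₁ : p + q = s) (h₂ : s + r = n) (h₃ : q + r = t)
    (h₄ : p + t = n) (α : DForm m M p) (β : DForm m M q) (γ : DForm m M r) :
    wedge h₂ (wedge h₁ α β) γ = wedge h₄ α (wedge h₃ β γ) := by
  refine DForm.ext_target fun e y _ => ?_
  simp only [wedge_val]
  exact altWedge_assoc h₁ h₂ h₃ h₄ _ _ _

theorem wedge_comm (h : p + q = n) (h' : q + p = n) (α : DForm m M p) (β : DForm m M q) :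
    wedge h α β = (-1 : ℝ) ^ (p * q) • wedge h' β α := by
  refine DForm.ext_target fun e y _ => ?_
  exact altWedge_comm h h' _ _

theorem DForm.differentiableAt_val (α : DForm m M p) (e : atlas (Model m) M) {y : Model m}
    (hy : y ∈ e.1.target) : DifferentiableAt ℝ (α.1 e) y :=
  ((α.2.1 e).contDiffAt (e.1.open_target.mem_nhds hy)).differentiableAt (by simp)

section Smooth

variable [IsManifold (𝓡 m) ∞ M]

theorem extd_val (α : DForm m M p) (e : atlas (Model m) M) {y : Model m} (hy : y ∈ e.1.target) :
    (extd p α).1 e y = extDeriv (α.1 e) y :=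
  Set.indicator_of_mem hy _

theorem extd_wedge (h : p + q = n) (h₁ : p + 1 + q = n + 1) (h₂ : p + (q + 1) = n + 1)
    (α : DForm m M p) (β : DForm m M q) :
    extd n (wedge h α β) =
      wedge h₁ (extd p α) β + (-1 : ℝ) ^ p • wedge h₂ α (extd q β) := by
  refine DForm.ext_target fun e y hy => ?_
  rw [extd_val _ e hy]
  change extDeriv (fun z => altWedge h (α.1 e z) (β.1 e z)) y =
    altWedge h₁ ((extd p α).1 e y) (β.1 e y) +
      (-1 : ℝ) ^ p • altWedge h₂ (α.1 e y) ((extd q β).1 e y)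
  rw [extDeriv_altWedge h h₁ h₂ (DForm.differentiableAt_val α e hy)
    (DForm.differentiableAt_val β e hy),
    extd_val _ e hy, extd_val _ e hy]

theorem extd_extd (α : DForm m M p) : extd (p + 1) (extd p α) = 0 := by
  refine DForm.ext_target fun e y hy => ?_
  rw [extd_val _ e hy]
  have h1 : (extd p α).1 e =ᶠ[nhds y] extDeriv (α.1 e) := by
    filter_upwards [e.1.open_target.mem_nhds hy] with z hz
    exact extd_val _ e hz
  rw [h1.extDeriv_eq, extDeriv_extDeriv_apply
    ((α.2.1 e).contDiffAt (e.1.open_target.mem_nhds hy)) (by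
      simpa using (WithTop.coe_le_coe.2 le_top :
        ((2 : ℕ∞) : WithTop ℕ∞) ≤ ((⊤ : ℕ∞) : WithTop ℕ∞)))]
  rfl

/-- The product of a smooth function and a differential form. -/
def funSmul (f : C^∞⟮𝓡 m, M; ℝ⟯) (α : DForm m M p) : DForm m M p :=
  ⟨fun e y => f (e.1.symm y) • α.1 e y, by
    refine ⟨fun e => ?_, fun e e' y hy => ?_, fun e y hy => ?_⟩
    · have h1 : ContDiffOn ℝ ∞ (fun y => f (e.1.symm y)) e.1.target := by
        rw [← contMDiffOn_iff_contDiffOn]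
        exact f.contMDiff.comp_contMDiffOn
          (contMDiffOn_symm_of_mem_maximalAtlas (IsManifold.subset_maximalAtlas e.2))
      exact h1.smul (α.2.1 e)
    · beta_reduce
      have hy' : e.1.symm y ∈ e'.1.source := by
        have := hy; simp at this; exact this.2
      rw [α.2.2.1 e e' y hy, e'.1.left_inv hy']
      rfl
    · beta_reduce
      rw [α.2.2.2 e y hy, smul_zero]⟩

theorem funSmul_val (f : C^∞⟮𝓡 m, M; ℝ⟯) (α : DForm m M p) (e : atlas (Model m) M) (y : Model m) :
    (funSmul f α).1 e y = f (e.1.symm y) • α.1 e y := rfl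

end Smooth

theorem extDeriv_eq_zero_of_eventuallyEq {f : Model m → Alt m p} {y : Model m}
    (hf : f =ᶠ[nhds y] fun _ => 0) : extDeriv f y = 0 := by
  rw [hf.extDeriv_eq, extDeriv, fderiv_fun_const, Pi.zero_apply,
    ← ContinuousAlternatingMap.alternatizeUncurryFinCLM_apply, map_zero]

/-- The form `α` vanishes outside the subset `K` of the manifold. -/
def VanishesOff (α : DForm m M p) (K : Set M) : Prop :=
  ∀ e : atlas (Model m) M, ∀ y ∈ e.1.target, e.1.symm y ∉ K → α.1 e y = 0

end FormCalculus

/-! ### Stokes' theorem -/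

section Stokes

/-- On the standard basis, the pullback of a form of top degree is multiplication by the
determinant. -/
theorem alt_comp_det {m : ℕ} (f : Alt m m) (L : Model m →L[ℝ] Model m)
    (b : Fin m → Model m) (hb : b = fun i => EuclideanSpace.basisFun (Fin m) ℝ i) :
    f.compContinuousLinearMap L b = L.det * f b := by
  subst hb
  set e := (EuclideanSpace.basisFun (Fin m) ℝ).toBasis with he
  have h1 := AlternatingMap.eq_smul_basis_det e f.toAlternatingMap
  have h2 : ∀ v, f v = f (fun i => EuclideanSpace.basisFun (Fin m) ℝ i) * e.det v := by
    intro v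
    have := congrArg (fun F => F v) h1
    rw [AlternatingMap.smul_apply, smul_eq_mul, he, OrthonormalBasis.coe_toBasis] at this
    exact this
  have h3 := e.det_comp (L : Model m →ₗ[ℝ] Model m) e
  rw [e.det_self, mul_one] at h3
  rw [ContinuousAlternatingMap.compContinuousLinearMap_apply, h2]
  have h4 : (⇑L ∘ fun i => EuclideanSpace.basisFun (Fin m) ℝ i) =
      ⇑(L : Model m →ₗ[ℝ] Model m) ∘ ⇑e := by
    funext i
    simp [he]
  rw [h4, h3, mul_comm]

variable {m : ℕ} {M : Type*} [TopologicalSpace M] [ChartedSpace (Model m) M]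
  [IsManifold (𝓡 m) ∞ M]

section Localize

variable [T2Space M] [CompactSpace M]

/-- The contribution of the chart at `x'` to the integral of a form supported in the domain of the
chart at `x` can be computed in the latter chart. -/
theorem chartIntegral_eq_of_vanishesOff (hor : OrientedAtlas m M) (η : DForm m M m) (x : M)
    {K : Set M} (hK : K ⊆ (chartAt (Model m) x).source) (hη : VanishesOff η K) (x' : M) :
    chartIntegral η x' = ∫ y in (chartAt (Model m) x).target,
      partition m M x' ((chartAt (Model m) x).symm y) * topCoeff η x y := by
  set e := chartAt (Model m) x
  set e' := chartAt (Model m) x'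
  let E : atlas (Model m) M := ⟨e, chart_mem_atlas _ x⟩
  let E' : atlas (Model m) M := ⟨e', chart_mem_atlas _ x'⟩
  set U := (e.symm.trans e').source with hU
  have hUo : IsOpen U := (e.symm.trans e').open_source
  have hUsub : U ⊆ e.target := fun y hy => by simp [hU] at hy; exact hy.1
  have hU2 : ∀ y ∈ U, e.symm y ∈ e'.source := fun y hy => by simp [hU] at hy; exact hy.2
  set φ : Model m → Model m := fun z => e' (e.symm z) with hφ
  have himg : φ '' U = (e'.symm.trans e).source := by
    ext y
    constructor
    · rintro ⟨z, hz, rfl⟩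
      have h1 := hU2 z hz
      simp [hφ, e'.map_source h1, e'.left_inv h1, e.map_target (hUsub hz)]
    · intro hy
      simp at hy
      refine ⟨e (e'.symm y), ?_, ?_⟩
      · simp [hU, e.map_source hy.2, e.left_inv hy.2, e'.map_target hy.1]
      · simp [hφ, e.left_inv hy.2, e'.right_inv hy.1]
  have hinj : Set.InjOn φ U := by
    intro a ha b hb hab
    have h1 := e'.injOn (hU2 a ha) (hU2 b hb) hab
    exact e.symm.injOn (hUsub ha) (hUsub hb) h1
  -- Both integrals may be restricted to the overlap of the charts: `η` vanishes outside `K` on the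
  -- one side, and the partition function outside the domain of the chart at `x'` on the other.
  have hL : chartIntegral η x' =
      ∫ y in φ '' U, partition m M x' (e'.symm y) * topCoeff η x' y := by
    rw [chartIntegral]
    refine setIntegral_eq_of_subset_of_forall_sdiff_eq_zero e'.open_target.measurableSet ?_ ?_
    · rw [himg]
      intro y hy
      simp at hy
      exact hy.1
    · rintro y ⟨hy, hyn⟩
      have : e'.symm y ∉ K := fun hk => hyn (by
        rw [himg]; simp only [OpenPartialHomeomorph.trans_source,
          OpenPartialHomeomorph.symm_source, Set.mem_inter_iff, Set.mem_preimage]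
        exact ⟨hy, hK hk⟩)
      have h0 : η.1 E' y = 0 := hη E' y hy this
      have : topCoeff η x' y = 0 := by
        change η.1 E' y _ = 0
        rw [h0]; rfl
      rw [this, mul_zero]
  have hR : (∫ y in e.target, partition m M x' (e.symm y) * topCoeff η x y) =
      ∫ y in U, partition m M x' (e.symm y) * topCoeff η x y := by
    refine setIntegral_eq_of_subset_of_forall_sdiff_eq_zero e.open_target.measurableSet hUsub ?_
    rintro y ⟨hy, hyn⟩
    have : e.symm y ∉ tsupport (partition m M x') := fun hk => hyn (by
      simp only [hU, OpenPartialHomeomorph.trans_source,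
          OpenPartialHomeomorph.symm_source, Set.mem_inter_iff, Set.mem_preimage]
      exact ⟨hy, partition_isSubordinate x' hk⟩)
    rw [image_eq_zero_of_notMem_tsupport this, zero_mul]
  have hd : ∀ y ∈ U, HasFDerivWithinAt φ (fderiv ℝ φ y) U y := fun y hy =>
    ((transition_contDiffAt E E' hy).differentiableAt (by simp)).hasFDerivAt.hasFDerivWithinAt
  rw [hL, hR, integral_image_eq_integral_abs_det_fderiv_smul volume hUo.measurableSet hd hinj]
  refine setIntegral_congr_fun hUo.measurableSet fun y hy => ?_
  have h1 : topCoeff η x y = (fderiv ℝ φ y).det * topCoeff η x' (φ y) := by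
    change η.1 E y _ = _ * η.1 E' (φ y) _
    rw [η.2.2.1 E E' y hy]
    exact alt_comp_det _ _ _ rfl
  rw [h1, abs_of_pos (hor E E' y hy), smul_eq_mul]
  simp only [hφ, e'.left_inv (hU2 y hy)]
  ring

/-- The integral of a form supported in the domain of a single chart can be computed in this chart. -/
theorem integral_eq_of_vanishesOff (hor : OrientedAtlas m M) (η : DForm m M m) (x : M)
    {K : Set M} (hKc : IsCompact K) (hK : K ⊆ (chartAt (Model m) x).source)
    (hη : VanishesOff η K) :
    integral η = ∫ y in (chartAt (Model m) x).target, topCoeff η x y := by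
  set e := chartAt (Model m) x
  let E : atlas (Model m) M := ⟨e, chart_mem_atlas _ x⟩
  have hfin : {x' | (Function.support (partition m M x')).Nonempty}.Finite :=
    (partition m M).locallyFinite.finite_nonempty_of_compact
  have hsub : Function.support (chartIntegral η) ⊆ hfin.toFinset := by
    intro x' hx'
    rw [Set.Finite.coe_toFinset]
    by_contra hne
    apply hx'
    have h0 : ∀ z, partition m M x' z = 0 := fun z => by
      by_contra hz
      exact hne ⟨z, hz⟩
    simp [chartIntegral, h0]
  change ∑ᶠ x', chartIntegral η x' = _
  rw [finsum_eq_sum_of_support_subset _ hsub]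
  rw [Finset.sum_congr rfl fun x' _ => chartIntegral_eq_of_vanishesOff hor η x hK hη x',
    ← integral_finsetSum]
  · refine setIntegral_congr_fun e.open_target.measurableSet fun y hy => ?_
    rw [← Finset.sum_mul]
    have h1 := (partition m M).sum_eq_one (Set.mem_univ (e.symm y))
    rw [finsum_eq_sum_of_support_subset (s := hfin.toFinset)] at h1
    · rw [h1, one_mul]
    · intro x' hx'
      rw [Set.Finite.coe_toFinset]
      exact ⟨_, hx'⟩
  · intro x' _
    have hc : ContinuousOn (fun y => partition m M x' (e.symm y) * topCoeff η x y) e.target := by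
      refine ContinuousOn.mul ?_ ?_
      · exact (partition m M x').contMDiff.continuous.comp_continuousOn e.continuousOn_symm
      · have h1 := (η.2.1 E).continuousOn
        intro y hy
        exact ((ContinuousAlternatingMap.apply ℝ (Model m) ℝ
          (fun i => EuclideanSpace.basisFun (Fin m) ℝ i)).continuous.continuousAt).comp_continuousWithinAt
            (h1 y hy)
    have hKc' : IsCompact (e '' K) := hKc.image_of_continuousOn (e.continuousOn.mono hK)
    have hKt : e '' K ⊆ e.target := by
      rintro _ ⟨z, hz, rfl⟩
      exact e.map_source (hK hz)
    refine ((hc.mono hKt).integrableOn_compact hKc').of_forall_sdiff_eq_zero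
      e.open_target.measurableSet ?_
    rintro y ⟨hy, hyK⟩
    have h0 : η.1 E y = 0 := hη E y hy fun hz => hyK ⟨e.symm y, hz, e.right_inv hy⟩
    have : topCoeff η x y = 0 := by
      change η.1 E y _ = 0
      rw [h0]; rfl
    rw [this, mul_zero]

end Localize

theorem integral_fderiv_apply_eq_zero {V : Type*} [NormedAddCommGroup V] [NormedSpace ℝ V]
    [FiniteDimensional ℝ V] [MeasurableSpace V] [BorelSpace V] (μ : Measure V)
    [μ.IsAddHaarMeasure] {f : V → ℝ} (hf : ContDiff ℝ 1 f) (hs : HasCompactSupport f) (v : V) :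
    Integrable (fun y => fderiv ℝ f y v) μ ∧ ∫ y, fderiv ℝ f y v ∂μ = 0 := by
  have hi : Integrable (fun y => fderiv ℝ f y v) μ :=
    ((hf.continuous_fderiv (by simp)).clm_apply continuous_const).integrable_of_hasCompactSupport
      (hs.fderiv_apply ℝ v)
  refine ⟨hi, ?_⟩
  -- Integration by parts against the constant function `1`.
  have h1 := integral_mul_fderiv_eq_neg_fderiv_mul_of_integrable (μ := μ) (f := fun _ : V => (1 : ℝ))
    (g := f) (v := v) (by simp) (by simpa using hi)
    (by simpa using hf.continuous.integrable_of_hasCompactSupport hs)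
    (fun _ _ => differentiableAt_const _) (fun _ _ => hf.differentiable (by simp) _)
  simpa using h1

/-- Stokes' theorem for compactly supported forms on Euclidean space. -/
theorem integral_extDeriv_eq_zero {n : ℕ} {ξ : Model (n + 1) → Alt (n + 1) n}
    (hξ : ContDiff ℝ ∞ ξ) (hs : HasCompactSupport ξ) (v : Fin (n + 1) → Model (n + 1)) :
    ∫ y, extDeriv ξ y v = 0 := by
  have h1 : ∀ y, extDeriv ξ y v =
      ∑ i : Fin (n + 1), (-1 : ℝ) ^ (i : ℕ) • fderiv ℝ (fun z => ξ z (i.removeNth v)) y (v i) := by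
    intro y
    rw [extDeriv_apply (hξ.differentiable (by simp) y)]
    refine Finset.sum_congr rfl fun i _ => ?_
    rw [← Int.cast_smul_eq_zsmul ℝ]
    simp
  have h2 : ∀ i : Fin (n + 1), _ := fun i =>
    integral_fderiv_apply_eq_zero (volume : Measure (Model (n + 1)))
      (f := fun z => ξ z (i.removeNth v))
      (((ContinuousAlternatingMap.apply ℝ (Model (n + 1)) ℝ (i.removeNth v)).contDiff.comp
        hξ).of_le (by simp))
      (hs.comp_left (g := fun k : Alt (n + 1) n => k (i.removeNth v)) rfl) (v i)
  simp only [h1]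
  refine (integral_finsetSum Finset.univ fun i _ => (h2 i).1.smul ((-1 : ℝ) ^ (i : ℕ))).trans ?_
  refine Finset.sum_eq_zero fun i _ => ?_
  exact (integral_smul ((-1 : ℝ) ^ (i : ℕ)) _).trans (by rw [(h2 i).2, smul_zero])

variable {n : ℕ} {N : Type*} [TopologicalSpace N] [ChartedSpace (Model (n + 1)) N]
  [IsManifold (𝓡 (n + 1)) ∞ N] [T2Space N] [CompactSpace N]

theorem VanishesOff.extd {p : ℕ} {ξ : DForm m M p} {K : Set M} (hK : IsClosed K)
    (hξ : VanishesOff ξ K) : VanishesOff (BFTheory.extd p ξ) K := by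
  intro e y hy hyK
  rw [extd_val _ e hy]
  have h1 : ξ.1 e =ᶠ[nhds y] fun _ => 0 := by
    have h2 : e.1.target ∩ e.1.symm ⁻¹' Kᶜ ∈ nhds y :=
      (e.1.isOpen_inter_preimage_symm hK.isOpen_compl).mem_nhds ⟨hy, hyK⟩
    filter_upwards [h2] with z hz
    exact hξ e z hz.1 hz.2
  exact extDeriv_eq_zero_of_eventuallyEq h1

/-- Stokes' theorem for a form supported in the domain of a chart. -/
theorem integral_extd_eq_zero_of_vanishesOff (hor : OrientedAtlas (n + 1) N)
    (ξ : DForm (n + 1) N n) (x : N) {K : Set N} (hKc : IsCompact K)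
    (hK : K ⊆ (chartAt (Model (n + 1)) x).source) (hξ : VanishesOff ξ K) :
    integral (extd n ξ) = 0 := by
  rw [integral_eq_of_vanishesOff hor (extd n ξ) x hKc hK (hξ.extd hKc.isClosed)]
  set e := chartAt (Model (n + 1)) x
  let E : atlas (Model (n + 1)) N := ⟨e, chart_mem_atlas _ x⟩
  have hKc' : IsCompact (e '' K) := hKc.image_of_continuousOn (e.continuousOn.mono hK)
  have hKt : e '' K ⊆ e.target := by
    rintro _ ⟨z, hz, rfl⟩
    exact e.map_source (hK hz)
  have h0 : ∀ y ∉ e '' K, ξ.1 E y = 0 := by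
    intro y hy
    by_cases hyt : y ∈ e.target
    · exact hξ E y hyt fun hz => hy ⟨e.symm y, hz, e.right_inv hyt⟩
    · exact ξ.2.2.2 E y hyt
  have hnear : ∀ y ∉ e '' K, ξ.1 E =ᶠ[nhds y] fun _ => 0 := fun y hy => by
    filter_upwards [hKc'.isClosed.isOpen_compl.mem_nhds hy] with z hz
    exact h0 z hz
  have hsm : ContDiff ℝ ∞ (ξ.1 E) := by
    rw [contDiff_iff_contDiffAt]
    intro y
    by_cases hy : y ∈ e '' K
    · exact (ξ.2.1 E).contDiffAt (e.open_target.mem_nhds (hKt hy))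
    · exact contDiffAt_const.congr_of_eventuallyEq (hnear y hy)
  have hcs : HasCompactSupport (ξ.1 E) := HasCompactSupport.intro hKc' h0
  have hout : ∀ y ∉ e.target,
      extDeriv (ξ.1 E) y (fun i => EuclideanSpace.basisFun (Fin (n + 1)) ℝ i) = 0 := fun y hy => by
    rw [extDeriv_eq_zero_of_eventuallyEq (hnear y fun h => hy (hKt h))]
    rfl
  rw [← integral_extDeriv_eq_zero hsm hcs (fun i => EuclideanSpace.basisFun (Fin (n + 1)) ℝ i),
    ← setIntegral_eq_integral_of_forall_compl_eq_zero hout]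
  refine setIntegral_congr_fun e.open_target.measurableSet fun y hy => ?_
  change (extd n ξ).1 E y _ = _
  rw [extd_val _ E hy]

/-- **Stokes' theorem** on a closed oriented manifold. -/
theorem integral_extd_eq_zero (hor : OrientedAtlas (n + 1) N) (ξ : DForm (n + 1) N n) :
    integral (extd n ξ) = 0 := by
  have hfin : {x | (Function.support (partition (n + 1) N x)).Nonempty}.Finite :=
    (partition (n + 1) N).locallyFinite.finite_nonempty_of_compact
  have hξ : ξ = ∑ x ∈ hfin.toFinset, funSmul (partition (n + 1) N x) ξ := by
    refine DForm.ext_target fun e y hy => ?_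
    have h1 := (partition (n + 1) N).sum_eq_one (Set.mem_univ (e.1.symm y))
    rw [finsum_eq_sum_of_support_subset (s := hfin.toFinset)] at h1
    · have : (∑ x ∈ hfin.toFinset, funSmul (partition (n + 1) N x) ξ).1 e y =
          ∑ x ∈ hfin.toFinset, (partition (n + 1) N x) (e.1.symm y) • ξ.1 e y := by
        simp [funSmul_val]
      rw [this, ← Finset.sum_smul, h1, one_smul]
    · intro x' hx'
      rw [Set.Finite.coe_toFinset]
      exact ⟨_, hx'⟩
  rw [hξ, map_sum, map_sum]
  refine Finset.sum_eq_zero fun x _ => ?_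
  refine integral_extd_eq_zero_of_vanishesOff hor _ x (isClosed_tsupport _).isCompact
    (partition_isSubordinate x) fun e y _ hyK => ?_
  rw [funSmul_val, image_eq_zero_of_notMem_tsupport hyK, zero_smul]

end Stokes

/-! ### Operations on homogeneous superforms -/

section Homogeneous

theorem neg_one_zpow_congr {a b : ℤ} (h : Even (a + b)) : (-1 : ℝ) ^ a = (-1 : ℝ) ^ b := by
  rcases Int.even_or_odd a with ha | ha
  · rw [ha.neg_one_zpow, ((Int.even_add.1 h).1 ha).neg_one_zpow]
  · have hb : Odd b := by
      rw [← Int.not_even_iff_odd] at ha ⊢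
      rwa [← Int.even_add.1 h]
    rw [ha.neg_one_zpow, hb.neg_one_zpow]

theorem neg_one_zpow_add (a b : ℤ) : (-1 : ℝ) ^ a * (-1 : ℝ) ^ b = (-1 : ℝ) ^ (a + b) :=
  (zpow_add₀ (by norm_num) a b).symm

variable {m : ℕ} {M : Type v} [TopologicalSpace M] [ChartedSpace (Model m) M]
variable {𝔤 : Type w} [LieRing 𝔤] [LieAlgebra ℝ 𝔤] {E : SuperAlg.{u}}
variable {p q r n : ℕ} {g g' : ℤ}

/-- Superforms of a given form degree are sums of pure tensors `μ ⊗ (x ⊗ e)`. -/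
@[elab_as_elim]
theorem SForm.induction_on {P : SForm m M 𝔤 E p → Prop} (α : SForm m M 𝔤 E p) (zero : P 0)
    (add : ∀ α β, P α → P β → P (α + β))
    (tmul : ∀ (μ : DForm m M p) (x : 𝔤) (e : E), P (μ ⊗ₜ (x ⊗ₜ e))) : P α := by
  induction α using TensorProduct.induction_on with
  | zero => exact zero
  | add _ _ h1 h2 => exact add _ _ h1 h2
  | tmul μ u =>
    induction u using TensorProduct.induction_on with
    | zero => simpa using zero
    | add _ _ h1 h2 => rw [TensorProduct.tmul_add]; exact add _ _ h1 h2
    | tmul x e => exact tmul μ x e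

/-- Superforms of a given form degree and ghost number `g` are sums of pure tensors
`μ ⊗ (x ⊗ e)` with `e` of degree `g`. -/
theorem ghostPart_induction {P : SForm m M 𝔤 E p → Prop} (zero : P 0)
    (add : ∀ α β, P α → P β → P (α + β))
    (tmul : ∀ (μ : DForm m M p) (x : 𝔤) (e : E), e ∈ E.gr g → P (μ ⊗ₜ (x ⊗ₜ e)))
    {α : SForm m M 𝔤 E p} (hα : α ∈ ghostPart m M 𝔤 E p g) : P α := by
  obtain ⟨α, rfl⟩ := hα
  induction α using TensorProduct.induction_on with
  | zero => simpa using zero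
  | add _ _ h1 h2 => rw [map_add]; exact add _ _ h1 h2
  | tmul μ u =>
    induction u using TensorProduct.induction_on with
    | zero => simpa using zero
    | add _ _ h1 h2 => rw [TensorProduct.tmul_add, map_add]; exact add _ _ h1 h2
    | tmul x e => exact tmul μ x e e.2

theorem tmul_mem_ghostPart (μ : DForm m M p) (x : 𝔤) {e : E} (he : e ∈ E.gr g) :
    (μ ⊗ₜ[ℝ] (x ⊗ₜ[ℝ] e) : SForm m M 𝔤 E p) ∈ ghostPart m M 𝔤 E p g :=
  ⟨μ ⊗ₜ (x ⊗ₜ ⟨e, he⟩), rfl⟩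

theorem SForm.sign_of_mem (n : ℕ) {α : SForm m M 𝔤 E p} (hα : α ∈ ghostPart m M 𝔤 E p g) :
    SForm.sign n α = (-1 : ℝ) ^ (g * n) • α := by
  refine ghostPart_induction (P := fun α => SForm.sign n α = (-1 : ℝ) ^ (g * n) • α) (by simp)
    (fun α β h1 h2 => by rw [map_add, h1, h2, smul_add]) (fun μ x e he => ?_) hα
  simp only [SForm.sign, LinearMap.lTensor_tmul, E.ghostSign_of_mem n he, TensorProduct.tmul_smul]

theorem SForm.bracket_tmul (h : p + q = n) (μ : DForm m M p) (x : 𝔤) (e : E) (ν : DForm m M q)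
    (y : 𝔤) (f : E) :
    SForm.bracket h (μ ⊗ₜ[ℝ] (x ⊗ₜ[ℝ] e)) (ν ⊗ₜ[ℝ] (y ⊗ₜ[ℝ] f)) =
      wedge h μ ν ⊗ₜ[ℝ] (⁅x, y⁆ ⊗ₜ[ℝ] (e * f)) := rfl

theorem pure_smul_form (c : ℝ) (μ : DForm m M p) (x : 𝔤) (e : E) :
    ((c • μ) ⊗ₜ[ℝ] (x ⊗ₜ[ℝ] e) : SForm m M 𝔤 E p) = c • (μ ⊗ₜ[ℝ] (x ⊗ₜ[ℝ] e)) :=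
  (TensorProduct.smul_tmul' c μ _).symm

theorem pure_smul_coeff (c : ℝ) (μ : DForm m M p) (x : 𝔤) (e : E) :
    (μ ⊗ₜ[ℝ] (x ⊗ₜ[ℝ] (c • e)) : SForm m M 𝔤 E p) = c • (μ ⊗ₜ[ℝ] (x ⊗ₜ[ℝ] e)) := by
  rw [TensorProduct.tmul_smul, TensorProduct.tmul_smul]

theorem pure_smul_lie (c : ℝ) (μ : DForm m M p) (x : 𝔤) (e : E) :
    (μ ⊗ₜ[ℝ] ((c • x) ⊗ₜ[ℝ] e) : SForm m M 𝔤 E p) = c • (μ ⊗ₜ[ℝ] (x ⊗ₜ[ℝ] e)) := by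
  rw [← TensorProduct.smul_tmul', TensorProduct.tmul_smul]

theorem pure_add_lie (μ : DForm m M p) (x y : 𝔤) (e : E) :
    (μ ⊗ₜ[ℝ] ((x + y) ⊗ₜ[ℝ] e) : SForm m M 𝔤 E p) =
      μ ⊗ₜ[ℝ] (x ⊗ₜ[ℝ] e) + μ ⊗ₜ[ℝ] (y ⊗ₜ[ℝ] e) := by
  rw [TensorProduct.add_tmul, TensorProduct.tmul_add]

variable (m M 𝔤 E) in
/-- The bracket of forms of degrees `p` and `q`, as a map into the forms of an arbitrary degree `n`:
it is zero unless `p + q = n`. This allows sums over independent indices. -/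
def brk (p q n : ℕ) : SForm m M 𝔤 E p →ₗ[ℝ] SForm m M 𝔤 E q →ₗ[ℝ] SForm m M 𝔤 E n :=
  if h : p + q = n then SForm.bracket h else 0

theorem brk_of_eq (h : p + q = n) : brk m M 𝔤 E p q n = SForm.bracket h := dif_pos h

theorem brk_of_ne (h : p + q ≠ n) : brk m M 𝔤 E p q n = 0 := dif_neg h

theorem brk_mem {α : SForm m M 𝔤 E p} {β : SForm m M 𝔤 E q} (hα : α ∈ ghostPart m M 𝔤 E p g)
    (hβ : β ∈ ghostPart m M 𝔤 E q g') :
    brk m M 𝔤 E p q n α β ∈ ghostPart m M 𝔤 E n (g + g') := by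
  by_cases h : p + q = n
  · rw [brk_of_eq h]
    refine ghostPart_induction (P := fun α => SForm.bracket h α β ∈ ghostPart m M 𝔤 E n (g + g'))
      (by simp) (fun _ _ h1 h2 => by
        rw [map_add, LinearMap.add_apply]; exact Submodule.add_mem _ h1 h2)
      (fun μ x e he => ?_) hα
    refine ghostPart_induction
      (P := fun β => SForm.bracket h (μ ⊗ₜ[ℝ] (x ⊗ₜ[ℝ] e)) β ∈ ghostPart m M 𝔤 E n (g + g'))
      (by simp) (fun _ _ h1 h2 => by rw [map_add]; exact Submodule.add_mem _ h1 h2)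
      (fun ν y f hf => ?_) hβ
    rw [SForm.bracket_tmul]
    exact tmul_mem_ghostPart _ _ (SetLike.mul_mem_graded he hf)
  · rw [brk_of_ne h]
    exact Submodule.zero_mem _

theorem neg_one_pow_mul (p q : ℕ) : (-1 : ℝ) ^ (p * q) = (-1 : ℝ) ^ ((p : ℤ) * q) := by
  exact_mod_cast (zpow_natCast (-1 : ℝ) (p * q)).symm

/-- Interchanging the arguments of the bracket gives a minus sign from `𝔤`, a sign from the wedge
product, and a sign from the supercommutativity of `E`. -/
theorem brk_comm {α : SForm m M 𝔤 E p} {β : SForm m M 𝔤 E q} (hα : α ∈ ghostPart m M 𝔤 E p g)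
    (hβ : β ∈ ghostPart m M 𝔤 E q g') :
    brk m M 𝔤 E p q n α β =
      (-1 : ℝ) ^ (1 + (p : ℤ) * q + g * g') • brk m M 𝔤 E q p n β α := by
  by_cases h : p + q = n
  · have h' : q + p = n := by omega
    rw [brk_of_eq h, brk_of_eq h']
    refine ghostPart_induction (P := fun α => SForm.bracket h α β =
        (-1 : ℝ) ^ (1 + (p : ℤ) * q + g * g') • SForm.bracket h' β α)
      (by simp) (fun _ _ h1 h2 => by
        rw [map_add, LinearMap.add_apply, map_add, h1, h2, smul_add])
      (fun μ x e he => ?_) hα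
    refine ghostPart_induction (P := fun β => SForm.bracket h (μ ⊗ₜ[ℝ] (x ⊗ₜ[ℝ] e)) β =
        (-1 : ℝ) ^ (1 + (p : ℤ) * q + g * g') • SForm.bracket h' β (μ ⊗ₜ[ℝ] (x ⊗ₜ[ℝ] e)))
      (by simp) (fun _ _ h1 h2 => by
        rw [map_add, map_add, LinearMap.add_apply, h1, h2, smul_add])
      (fun ν y f hf => ?_) hβ
    have hxy : ⁅x, y⁆ = (-1 : ℝ) • ⁅y, x⁆ := by rw [neg_one_smul, lie_skew]
    rw [SForm.bracket_tmul, SForm.bracket_tmul, wedge_comm h h', E.supercomm g g' e he f hf,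
      hxy, ← neg_one_zpow_add, ← neg_one_zpow_add, zpow_one, pure_smul_form, pure_smul_coeff,
      pure_smul_lie, smul_smul, smul_smul, neg_one_pow_mul]
    congr 1
    ring
  · rw [brk_of_ne h, brk_of_ne (by omega : q + p ≠ n)]
    simp

theorem wedge_left_comm {s t : ℕ} (h₁ : q + r = s) (h₂ : p + s = n) (h₃ : p + r = t)
    (h₄ : q + t = n) (μ : DForm m M p) (ν : DForm m M q) (ξ : DForm m M r) :
    wedge h₂ μ (wedge h₁ ν ξ) = (-1 : ℝ) ^ (p * q) • wedge h₄ ν (wedge h₃ μ ξ) := by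
  rw [← wedge_assoc rfl (by omega) h₁ h₂, wedge_comm rfl (add_comm q p), map_smul,
    LinearMap.smul_apply, wedge_assoc (add_comm q p) _ h₃ h₄]

theorem bracket_leibniz_tmul (h : p + q + r = n) (h₁ : p + (q + r) = n) (h₂ : q + (p + r) = n)
    (μ : DForm m M p) (x : 𝔤) {e : E} (he : e ∈ E.gr g) (ν : DForm m M q) (y : 𝔤) {f : E}
    (hf : f ∈ E.gr g') (ξ : DForm m M r) (z : 𝔤) (k : E) :
    SForm.bracket h₁ (μ ⊗ₜ[ℝ] (x ⊗ₜ[ℝ] e))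
        (SForm.bracket (rfl : q + r = q + r) (ν ⊗ₜ[ℝ] (y ⊗ₜ[ℝ] f)) (ξ ⊗ₜ[ℝ] (z ⊗ₜ[ℝ] k))) =
      SForm.bracket h (SForm.bracket (rfl : p + q = p + q) (μ ⊗ₜ[ℝ] (x ⊗ₜ[ℝ] e))
        (ν ⊗ₜ[ℝ] (y ⊗ₜ[ℝ] f))) (ξ ⊗ₜ[ℝ] (z ⊗ₜ[ℝ] k)) +
      (-1 : ℝ) ^ ((p : ℤ) * q + g * g') • SForm.bracket h₂ (ν ⊗ₜ[ℝ] (y ⊗ₜ[ℝ] f))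
        (SForm.bracket (rfl : p + r = p + r) (μ ⊗ₜ[ℝ] (x ⊗ₜ[ℝ] e)) (ξ ⊗ₜ[ℝ] (z ⊗ₜ[ℝ] k))) := by
  have hw := wedge_left_comm rfl h₂ rfl h₁ ν μ ξ
  have hw' := wedge_assoc rfl h rfl h₁ μ ν ξ
  have he' : f * (e * k) = (-1 : ℝ) ^ (g * g') • (e * (f * k)) := by
    rw [← mul_assoc, E.supercomm g' g f hf e he, smul_mul_assoc, mul_assoc, mul_comm g' g]
  have hs : (-1 : ℝ) ^ ((p : ℤ) * q + g * g') * (-1 : ℝ) ^ (q * p) * (-1 : ℝ) ^ (g * g') = 1 := by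
    rw [mul_assoc, mul_comm q p, neg_one_pow_mul, neg_one_zpow_add, neg_one_zpow_add]
    exact Even.neg_one_zpow ⟨_, rfl⟩
  rw [SForm.bracket_tmul, SForm.bracket_tmul, SForm.bracket_tmul, SForm.bracket_tmul,
    SForm.bracket_tmul, SForm.bracket_tmul, hw, hw', he', leibniz_lie x y z, mul_assoc,
    pure_add_lie, pure_smul_form, pure_smul_coeff, smul_smul, smul_smul, hs, one_smul]

/-- The graded Jacobi identity, in Leibniz form. -/
theorem brk_leibniz {α : SForm m M 𝔤 E p} {β : SForm m M 𝔤 E q} (hα : α ∈ ghostPart m M 𝔤 E p g)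
    (hβ : β ∈ ghostPart m M 𝔤 E q g') (γ : SForm m M 𝔤 E r) :
    brk m M 𝔤 E p (q + r) n α (brk m M 𝔤 E q r (q + r) β γ) =
      brk m M 𝔤 E (p + q) r n (brk m M 𝔤 E p q (p + q) α β) γ +
      (-1 : ℝ) ^ ((p : ℤ) * q + g * g') •
        brk m M 𝔤 E q (p + r) n β (brk m M 𝔤 E p r (p + r) α γ) := by
  by_cases h : p + q + r = n
  · have h1 : p + (q + r) = n := by omega
    have h2 : q + (p + r) = n := by omega
    rw [brk_of_eq h, brk_of_eq h1, brk_of_eq h2, brk_of_eq (rfl : p + q = p + q),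
      brk_of_eq (rfl : q + r = q + r), brk_of_eq (rfl : p + r = p + r)]
    refine ghostPart_induction (P := fun α => SForm.bracket h1 α (SForm.bracket rfl β γ) =
        SForm.bracket h (SForm.bracket rfl α β) γ + (-1 : ℝ) ^ ((p : ℤ) * q + g * g') •
          SForm.bracket h2 β (SForm.bracket rfl α γ))
      (by simp) (fun _ _ h1 h2 => by
        simp only [map_add, LinearMap.add_apply, h1, h2, smul_add]; abel)
      (fun μ x e he => ?_) hα
    refine ghostPart_induction (P := fun β => SForm.bracket h1 (μ ⊗ₜ[ℝ] (x ⊗ₜ[ℝ] e))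
        (SForm.bracket rfl β γ) =
        SForm.bracket h (SForm.bracket rfl (μ ⊗ₜ[ℝ] (x ⊗ₜ[ℝ] e)) β) γ +
          (-1 : ℝ) ^ ((p : ℤ) * q + g * g') •
          SForm.bracket h2 β (SForm.bracket rfl (μ ⊗ₜ[ℝ] (x ⊗ₜ[ℝ] e)) γ))
      (by simp) (fun _ _ h1 h2 => by
        simp only [map_add, LinearMap.add_apply, h1, h2, smul_add]; abel)
      (fun ν y f hf => ?_) hβ
    refine SForm.induction_on γ (by simp) (fun _ _ h1 h2 => by
        simp only [map_add, h1, h2, smul_add]; abel) (fun ξ z k => ?_)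
    exact bracket_leibniz_tmul h h1 h2 μ x he ν y hf ξ z k
  · rw [brk_of_ne h, brk_of_ne (by omega : p + (q + r) ≠ n),
      brk_of_ne (by omega : q + (p + r) ≠ n)]
    simp

section Smooth

variable [IsManifold (𝓡 m) ∞ M]

variable (m M 𝔤 E) in
/-- The exterior derivative of forms with values in `𝔤 ⊗ E`. -/
def sd (p : ℕ) : SForm m M 𝔤 E p →ₗ[ℝ] SForm m M 𝔤 E (p + 1) := LinearMap.rTensor _ (extd p)

theorem sd_tmul (μ : DForm m M p) (x : 𝔤) (e : E) :
    sd m M 𝔤 E p (μ ⊗ₜ[ℝ] (x ⊗ₜ[ℝ] e)) = extd p μ ⊗ₜ[ℝ] (x ⊗ₜ[ℝ] e) := rfl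

theorem sd_mem {α : SForm m M 𝔤 E p} (hα : α ∈ ghostPart m M 𝔤 E p g) :
    sd m M 𝔤 E p α ∈ ghostPart m M 𝔤 E (p + 1) g := by
  refine ghostPart_induction (P := fun α => sd m M 𝔤 E p α ∈ ghostPart m M 𝔤 E (p + 1) g)
    (by simp) (fun _ _ h1 h2 => by rw [map_add]; exact Submodule.add_mem _ h1 h2)
    (fun μ x e he => tmul_mem_ghostPart _ _ he) hα

theorem sd_sd (α : SForm m M 𝔤 E p) : sd m M 𝔤 E (p + 1) (sd m M 𝔤 E p α) = 0 := by
  refine SForm.induction_on α (by simp) (fun _ _ h1 h2 => by simp [h1, h2]) fun μ x e => ?_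
  rw [sd_tmul, sd_tmul, extd_extd, TensorProduct.zero_tmul]

theorem sd_brk (α : SForm m M 𝔤 E p) (β : SForm m M 𝔤 E q) :
    sd m M 𝔤 E n (brk m M 𝔤 E p q n α β) =
      brk m M 𝔤 E (p + 1) q (n + 1) (sd m M 𝔤 E p α) β +
      (-1 : ℝ) ^ (p : ℤ) • brk m M 𝔤 E p (q + 1) (n + 1) α (sd m M 𝔤 E q β) := by
  by_cases h : p + q = n
  · have h1 : p + 1 + q = n + 1 := by omega
    have h2 : p + (q + 1) = n + 1 := by omega
    rw [brk_of_eq h, brk_of_eq h1, brk_of_eq h2]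
    refine SForm.induction_on α (by simp) (fun _ _ h1 h2 => by
      simp only [map_add, LinearMap.add_apply, h1, h2, smul_add]; abel) fun μ x e => ?_
    refine SForm.induction_on β (by simp) (fun _ _ h1 h2 => by
      simp only [map_add, h1, h2, smul_add]; abel) fun ν y f => ?_
    rw [SForm.bracket_tmul, sd_tmul, sd_tmul, sd_tmul, SForm.bracket_tmul, SForm.bracket_tmul,
      extd_wedge h h1 h2, TensorProduct.add_tmul, zpow_natCast, pure_smul_form]
  · rw [brk_of_ne h, brk_of_ne (by omega : p + 1 + q ≠ n + 1),
      brk_of_ne (by omega : p + (q + 1) ≠ n + 1)]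
    simp

variable [T2Space M] [CompactSpace M] (κ : LinearMap.BilinForm ℝ 𝔤)

theorem pairInt_of_ne (h : p + q ≠ m) (α : SForm m M 𝔤 E p) (β : SForm m M 𝔤 E q) :
    pairInt κ α β = 0 := by
  simp [pairInt, dif_neg h]

theorem pairInt_tmul (h : p + q = m) (μ : DForm m M p) (x : 𝔤) (e : E) (ν : DForm m M q)
    (y : 𝔤) (f : E) :
    pairInt κ (μ ⊗ₜ[ℝ] (x ⊗ₜ[ℝ] e) : SForm m M 𝔤 E p) (ν ⊗ₜ[ℝ] (y ⊗ₜ[ℝ] f) : SForm m M 𝔤 E q) =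
      integral (wedge h μ ν) • κ x y • (e * f) := by
  simp only [pairInt, dif_pos h]
  rfl

theorem pairInt_comm (hκ : κ.IsSymm) {α : SForm m M 𝔤 E p} {β : SForm m M 𝔤 E q}
    (hα : α ∈ ghostPart m M 𝔤 E p g) (hβ : β ∈ ghostPart m M 𝔤 E q g') :
    pairInt κ α β = (-1 : ℝ) ^ ((p : ℤ) * q + g * g') • pairInt κ β α := by
  by_cases h : p + q = m
  · have h' : q + p = m := by omega
    refine ghostPart_induction (P := fun α => pairInt κ α β =
        (-1 : ℝ) ^ ((p : ℤ) * q + g * g') • pairInt κ β α)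
      (by simp) (fun _ _ h1 h2 => by
        rw [map_add, LinearMap.add_apply, map_add, h1, h2, smul_add])
      (fun μ x e he => ?_) hα
    refine ghostPart_induction (P := fun β => pairInt κ (μ ⊗ₜ[ℝ] (x ⊗ₜ[ℝ] e)) β =
        (-1 : ℝ) ^ ((p : ℤ) * q + g * g') • pairInt κ β (μ ⊗ₜ[ℝ] (x ⊗ₜ[ℝ] e)))
      (by simp) (fun _ _ h1 h2 => by
        rw [map_add, map_add, LinearMap.add_apply, h1, h2, smul_add])
      (fun ν y f hf => ?_) hβ
    rw [pairInt_tmul κ h, pairInt_tmul κ h', wedge_comm h h', E.supercomm g g' e he f hf,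
      hκ.eq, ← neg_one_zpow_add, map_smul]
    simp only [smul_smul, neg_one_pow_mul, smul_eq_mul]
    congr 1
    ring
  · rw [pairInt_of_ne κ h, pairInt_of_ne κ (by omega : q + p ≠ m), smul_zero]

/-- The pairing is invariant; no sign arises as the order of the arguments is unchanged. -/
theorem pairInt_brk (hinv : κ.lieInvariant 𝔤) (α : SForm m M 𝔤 E p)
    (β : SForm m M 𝔤 E q) (γ : SForm m M 𝔤 E r) :
    pairInt κ (brk m M 𝔤 E p q (p + q) α β) γ = pairInt κ α (brk m M 𝔤 E q r (q + r) β γ) := by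
  by_cases h : p + q + r = m
  · have h' : p + (q + r) = m := by omega
    rw [brk_of_eq (rfl : p + q = p + q), brk_of_eq (rfl : q + r = q + r)]
    refine SForm.induction_on α (by simp) (fun _ _ h1 h2 => by
      simp only [map_add, LinearMap.add_apply, h1, h2]) fun μ x e => ?_
    refine SForm.induction_on β (by simp) (fun _ _ h1 h2 => by
      simp only [map_add, LinearMap.add_apply, h1, h2]) fun ν y f => ?_
    refine SForm.induction_on γ (by simp) (fun _ _ h1 h2 => by
      simp only [map_add, h1, h2]) fun ξ z k => ?_
    rw [SForm.bracket_tmul, SForm.bracket_tmul, pairInt_tmul κ h, pairInt_tmul κ h',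
      wedge_assoc rfl h rfl h', mul_assoc]
    have hxyz : κ ⁅x, y⁆ z = κ x ⁅y, z⁆ := by
      rw [← lie_skew x y, map_neg, LinearMap.neg_apply, hinv y x z, neg_neg]
    rw [hxyz]
  · rw [pairInt_of_ne κ h, pairInt_of_ne κ (by omega : p + (q + r) ≠ m)]

theorem integral_wedge_extd (hor : OrientedAtlas m M) (h₁ : p + 1 + q = m) (h₂ : p + (q + 1) = m)
    (μ : DForm m M p) (ν : DForm m M q) :
    integral (wedge h₁ (extd p μ) ν) + (-1 : ℝ) ^ p * integral (wedge h₂ μ (extd q ν)) = 0 := by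
  obtain rfl : m = p + q + 1 := by omega
  have := integral_extd_eq_zero hor (wedge (rfl : p + q = p + q) μ ν)
  rwa [extd_wedge rfl h₁ h₂, map_add, map_smul, smul_eq_mul] at this

/-- Integration by parts. -/
theorem pairInt_sd (hor : OrientedAtlas m M) (α : SForm m M 𝔤 E p) (β : SForm m M 𝔤 E q) :
    pairInt κ (sd m M 𝔤 E p α) β + (-1 : ℝ) ^ (p : ℤ) • pairInt κ α (sd m M 𝔤 E q β) = 0 := by
  by_cases h1 : p + 1 + q = m
  · have h2 : p + (q + 1) = m := by omega
    refine SForm.induction_on α (by simp) (fun α α' h1 h2 => by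
      simp only [map_add, LinearMap.add_apply, smul_add]
      rw [add_add_add_comm, h1, h2, add_zero]) fun μ x e => ?_
    refine SForm.induction_on β (by simp) (fun β β' h1 h2 => by
      simp only [map_add, smul_add]
      rw [add_add_add_comm, h1, h2, add_zero]) fun ν y f => ?_
    rw [sd_tmul, sd_tmul, pairInt_tmul κ h1, pairInt_tmul κ h2, zpow_natCast,
      smul_smul ((-1 : ℝ) ^ p), ← add_smul, integral_wedge_extd hor h1 h2, zero_smul]
  · rw [pairInt_of_ne κ h1, pairInt_of_ne κ (by omega : p + (q + 1) ≠ m), smul_zero, add_zero]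

end Smooth

end Homogeneous

/-! ### The differential graded Lie algebra of superforms -/

section SuperCalculus

variable {m : ℕ} {M : Type v} [TopologicalSpace M] [ChartedSpace (Model m) M]
variable {𝔤 : Type w} [LieRing 𝔤] [LieAlgebra ℝ 𝔤] {E : SuperAlg.{u}}
variable {k l : ℤ}

theorem component_mem {α : Superform m M 𝔤 E} (hα : α ∈ TotDeg m M 𝔤 E k) (p : ℕ) :
    α p ∈ ghostPart m M 𝔤 E p (k - p) := hα p (Set.mem_univ p)

theorem mem_TotDeg {α : Superform m M 𝔤 E} (h : ∀ p : ℕ, α p ∈ ghostPart m M 𝔤 E p (k - p)) :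
    α ∈ TotDeg m M 𝔤 E k := fun p _ => h p

/-- The bracket as a sum over independent form degrees. Any ranges exceeding `n` may be used, as all
other terms vanish. -/
theorem dotBracket_apply {α : Superform m M 𝔤 E} (hα : α ∈ TotDeg m M 𝔤 E k)
    (β : Superform m M 𝔤 E) {n N N' : ℕ} (hN : n < N) (hN' : n < N') :
    dotBracket α β n = ∑ i ∈ Finset.range N, ∑ j ∈ Finset.range N',
      (-1 : ℝ) ^ ((k - i) * j) • brk m M 𝔤 E i j n (α i) (β j) := by
  have h1 : ∀ i ≤ n, ∑ j ∈ Finset.range N',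
      (-1 : ℝ) ^ ((k - i) * j) • brk m M 𝔤 E i j n (α i) (β j) =
      brk m M 𝔤 E i (n - i) n (SForm.sign (n - i) (α i)) (β (n - i)) := by
    intro i hi
    rw [Finset.sum_eq_single (n - i)]
    · rw [SForm.sign_of_mem (n - i) (component_mem hα i), map_smul, LinearMap.smul_apply]
    · intro j _ hj
      rw [brk_of_ne (by omega : i + j ≠ n), LinearMap.zero_apply, LinearMap.zero_apply, smul_zero]
    · intro h
      exact absurd (Finset.mem_range.2 (by omega)) h
  have h2 : ∑ i ∈ Finset.range N, ∑ j ∈ Finset.range N',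
      (-1 : ℝ) ^ ((k - i) * j) • brk m M 𝔤 E i j n (α i) (β j) =
      ∑ i ∈ Finset.range (n + 1), ∑ j ∈ Finset.range N',
      (-1 : ℝ) ^ ((k - i) * j) • brk m M 𝔤 E i j n (α i) (β j) := by
    symm
    refine Finset.sum_subset (Finset.range_subset_range.2 hN) fun i _ hi => ?_
    rw [Finset.mem_range, not_lt] at hi
    refine Finset.sum_eq_zero fun j _ => ?_
    rw [brk_of_ne (by omega : i + j ≠ n), LinearMap.zero_apply, LinearMap.zero_apply, smul_zero]
  rw [h2, Finset.sum_congr rfl fun i hi => h1 i (by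
    rw [Finset.mem_range] at hi; omega), dotBracket,
    Finset.sum_range fun i => brk m M 𝔤 E i (n - i) n (SForm.sign (n - i) (α i)) (β (n - i))]
  refine Finset.sum_congr rfl fun i _ => ?_
  rw [brk_of_eq]

theorem dotBracket_mem {α β : Superform m M 𝔤 E} (hα : α ∈ TotDeg m M 𝔤 E k)
    (hβ : β ∈ TotDeg m M 𝔤 E l) : dotBracket α β ∈ TotDeg m M 𝔤 E (k + l) := by
  refine mem_TotDeg fun n => ?_
  rw [dotBracket_apply hα β (Nat.lt_succ_self n) (Nat.lt_succ_self n)]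
  refine Submodule.sum_mem _ fun i _ => Submodule.sum_mem _ fun j _ => Submodule.smul_mem _ _ ?_
  by_cases h : i + j = n
  · have := brk_mem (n := n) (component_mem hα i) (component_mem hβ j)
    rwa [show k - i + (l - j) = k + l - n by rw [← h]; push_cast; ring] at this
  · rw [brk_of_ne h]
    exact Submodule.zero_mem _

theorem dotBracket_add_left (α α' β : Superform m M 𝔤 E) :
    dotBracket (α + α') β = dotBracket α β + dotBracket α' β := by
  funext n
  simp only [dotBracket, Pi.add_apply, map_add, LinearMap.add_apply, Finset.sum_add_distrib]

theorem dotBracket_add_right (α β β' : Superform m M 𝔤 E) :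
    dotBracket α (β + β') = dotBracket α β + dotBracket α β' := by
  funext n
  simp only [dotBracket, Pi.add_apply, map_add, Finset.sum_add_distrib]

theorem dotBracket_smul_left (c : ℝ) (α β : Superform m M 𝔤 E) :
    dotBracket (c • α) β = c • dotBracket α β := by
  funext n
  simp only [dotBracket, Pi.smul_apply, map_smul, LinearMap.smul_apply, Finset.smul_sum]

theorem dotBracket_smul_right (c : ℝ) (α β : Superform m M 𝔤 E) :
    dotBracket α (c • β) = c • dotBracket α β := by
  funext n
  simp only [dotBracket, Pi.smul_apply, map_smul, Finset.smul_sum]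

/-- The bracket of superforms is graded antisymmetric with respect to the total degree. -/
theorem dotBracket_comm {α β : Superform m M 𝔤 E} (hα : α ∈ TotDeg m M 𝔤 E k)
    (hβ : β ∈ TotDeg m M 𝔤 E l) :
    dotBracket α β = (-1 : ℝ) ^ (1 + k * l) • dotBracket β α := by
  funext n
  rw [Pi.smul_apply, dotBracket_apply hα β (Nat.lt_succ_self n) (Nat.lt_succ_self n),
    dotBracket_apply hβ α (Nat.lt_succ_self n) (Nat.lt_succ_self n), Finset.sum_comm,
    Finset.smul_sum]
  refine Finset.sum_congr rfl fun j _ => ?_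
  rw [Finset.smul_sum]
  refine Finset.sum_congr rfl fun i _ => ?_
  rw [brk_comm (component_mem hα i) (component_mem hβ j), smul_smul, smul_smul, neg_one_zpow_add,
    neg_one_zpow_add]
  congr 1
  exact neg_one_zpow_congr ⟨1 + k * l, by ring⟩

/-- Linear maps `T s` on the components of `⟦β; γ⟧` are evaluated through the components of `β` and
`γ`: for given degrees `j` and `t` of these only the summand `s = j + t` contributes. -/
theorem sum_apply_dotBracket {X : Type*} [AddCommMonoid X] [Module ℝ X] {N : ℕ}
    (T : ∀ s : ℕ, SForm m M 𝔤 E s →ₗ[ℝ] X) (hT : ∀ s, N ≤ s → T s = 0) (c : ℕ → ℝ)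
    {β : Superform m M 𝔤 E} (hβ : β ∈ TotDeg m M 𝔤 E l) (γ : Superform m M 𝔤 E) :
    ∑ s ∈ Finset.range N, c s • T s (dotBracket β γ s) =
      ∑ j ∈ Finset.range N, ∑ t ∈ Finset.range N,
        (c (j + t) * (-1 : ℝ) ^ ((l - j) * t)) • T (j + t) (brk m M 𝔤 E j t (j + t) (β j) (γ t)) := by
  have h1 : ∀ s ∈ Finset.range N, c s • T s (dotBracket β γ s) =
      ∑ j ∈ Finset.range N, ∑ t ∈ Finset.range N,
        (c s * (-1 : ℝ) ^ ((l - j) * t)) • T s (brk m M 𝔤 E j t s (β j) (γ t)) := by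
    intro s hs
    rw [dotBracket_apply hβ γ (Finset.mem_range.1 hs) (Finset.mem_range.1 hs)]
    simp only [map_sum, map_smul, Finset.smul_sum, smul_smul]
  rw [Finset.sum_congr rfl h1, Finset.sum_comm]
  refine Finset.sum_congr rfl fun j _ => ?_
  rw [Finset.sum_comm]
  refine Finset.sum_congr rfl fun t _ => ?_
  have h2 : ∀ s, s ≠ j + t →
      (c s * (-1 : ℝ) ^ ((l - j) * t)) • T s (brk m M 𝔤 E j t s (β j) (γ t)) = 0 := by
    intro s hs
    rw [brk_of_ne (by omega : j + t ≠ s), LinearMap.zero_apply, LinearMap.zero_apply, map_zero,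
      smul_zero]
  by_cases h : j + t < N
  · exact Finset.sum_eq_single (j + t) (fun s _ hs => h2 s hs)
      fun h' => absurd (Finset.mem_range.2 h) h'
  · rw [hT (j + t) (by omega), LinearMap.zero_apply, smul_zero]
    exact Finset.sum_eq_zero fun s hs => h2 s (by
      rw [Finset.mem_range] at hs; omega)

theorem dotBracket_dotBracket_right {α β : Superform m M 𝔤 E} (hα : α ∈ TotDeg m M 𝔤 E k)
    (hβ : β ∈ TotDeg m M 𝔤 E l) (γ : Superform m M 𝔤 E) (n : ℕ) :
    dotBracket α (dotBracket β γ) n =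
      ∑ i ∈ Finset.range n.succ, ∑ j ∈ Finset.range n.succ, ∑ t ∈ Finset.range n.succ,
        ((-1 : ℝ) ^ ((k - i) * (j + t : ℕ)) * (-1 : ℝ) ^ ((l - j) * t)) •
          brk m M 𝔤 E i (j + t) n (α i) (brk m M 𝔤 E j t (j + t) (β j) (γ t)) := by
  rw [dotBracket_apply hα _ (Nat.lt_succ_self n) (Nat.lt_succ_self n)]
  refine Finset.sum_congr rfl fun i _ => ?_
  refine sum_apply_dotBracket (fun s => brk m M 𝔤 E i s n (α i)) (fun s hs => ?_)
      (fun s => (-1 : ℝ) ^ ((k - i) * s)) hβ γ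
  rw [brk_of_ne (by omega), LinearMap.zero_apply]

theorem dotBracket_dotBracket_left {α β : Superform m M 𝔤 E} (hα : α ∈ TotDeg m M 𝔤 E k)
    (hβ : β ∈ TotDeg m M 𝔤 E l) (γ : Superform m M 𝔤 E) (n : ℕ) :
    dotBracket (dotBracket α β) γ n =
      ∑ i ∈ Finset.range n.succ, ∑ j ∈ Finset.range n.succ, ∑ t ∈ Finset.range n.succ,
        ((-1 : ℝ) ^ ((k + l - (i + j : ℕ)) * t) * (-1 : ℝ) ^ ((k - i) * j)) •
          brk m M 𝔤 E (i + j) t n (brk m M 𝔤 E i j (i + j) (α i) (β j)) (γ t) := by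
  rw [dotBracket_apply (dotBracket_mem hα hβ) _ (Nat.lt_succ_self n) (Nat.lt_succ_self n),
    Finset.sum_comm, Finset.sum_congr rfl fun i _ => Finset.sum_comm]
  refine Eq.trans (Finset.sum_congr rfl fun t _ => ?_) Finset.sum_comm
  refine (sum_apply_dotBracket (fun s => (brk m M 𝔤 E s t n).flip (γ t)) (fun s hs => ?_)
      (fun s => (-1 : ℝ) ^ ((k + l - s) * t)) hα β).trans ?_
  · rw [brk_of_ne (by omega)]
    exact LinearMap.ext fun x => rfl
  · rfl

/-- The graded Jacobi identity for superforms. -/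
theorem dotBracket_leibniz {α β : Superform m M 𝔤 E} (hα : α ∈ TotDeg m M 𝔤 E k)
    (hβ : β ∈ TotDeg m M 𝔤 E l) (γ : Superform m M 𝔤 E) :
    dotBracket α (dotBracket β γ) =
      dotBracket (dotBracket α β) γ + (-1 : ℝ) ^ (k * l) • dotBracket β (dotBracket α γ) := by
  funext n
  rw [Pi.add_apply, Pi.smul_apply, dotBracket_dotBracket_right hα hβ,
    dotBracket_dotBracket_left hα hβ, dotBracket_dotBracket_right hβ hα,
    Finset.sum_comm (f := fun j i => ∑ t ∈ Finset.range n.succ,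
      ((-1 : ℝ) ^ ((l - (j : ℕ)) * (i + t : ℕ)) * (-1 : ℝ) ^ ((k - (i : ℕ)) * t)) •
          brk m M 𝔤 E j (i + t) n (β j) (brk m M 𝔤 E i t (i + t) (α i) (γ t))), Finset.smul_sum,
    ← Finset.sum_add_distrib]
  refine Finset.sum_congr rfl fun i _ => ?_
  rw [Finset.smul_sum, ← Finset.sum_add_distrib]
  refine Finset.sum_congr rfl fun j _ => ?_
  rw [Finset.smul_sum, ← Finset.sum_add_distrib]
  refine Finset.sum_congr rfl fun t _ => ?_
  rw [brk_leibniz (component_mem hα i) (component_mem hβ j), smul_add]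
  simp only [smul_smul, neg_one_zpow_add]
  congr 2
  · refine neg_one_zpow_congr ⟨(k - i) * j + (k + l - i - j) * t, ?_⟩
    push_cast
    ring
  · refine neg_one_zpow_congr ⟨k * l + k * t - i * t + l * t - j * t, ?_⟩
    push_cast
    ring

end SuperCalculus

/-! ### Exterior derivative and integration of superforms -/

section SuperIntegral

variable {m : ℕ} {M : Type v} [TopologicalSpace M] [ChartedSpace (Model m) M]
variable {𝔤 : Type w} [LieRing 𝔤] [LieAlgebra ℝ 𝔤] {E : SuperAlg.{u}}
variable [IsManifold (𝓡 m) ∞ M] {k l : ℤ}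

theorem superd_zero (α : Superform m M 𝔤 E) : superd α 0 = 0 := rfl

theorem superd_succ (α : Superform m M 𝔤 E) (p : ℕ) : superd α (p + 1) = sd m M 𝔤 E p (α p) := rfl

theorem superd_mem {α : Superform m M 𝔤 E} (hα : α ∈ TotDeg m M 𝔤 E k) :
    superd α ∈ TotDeg m M 𝔤 E (k + 1) := by
  refine mem_TotDeg fun n => ?_
  cases n with
  | zero => exact Submodule.zero_mem _
  | succ p =>
    have := sd_mem (component_mem hα p)
    rwa [show k - (p : ℤ) = k + 1 - (p + 1 : ℕ) by push_cast; ring] at this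

theorem superd_superd (α : Superform m M 𝔤 E) : superd (superd α) = 0 := by
  funext n
  rcases n with _ | _ | p
  · rfl
  · rw [superd_succ, superd_zero, map_zero]
    rfl
  · rw [superd_succ, superd_succ, sd_sd]
    rfl

theorem superd_add (α β : Superform m M 𝔤 E) : superd (α + β) = superd α + superd β := by
  funext n
  cases n with
  | zero => exact (add_zero _).symm
  | succ p =>
    rw [Pi.add_apply, superd_succ, superd_succ, superd_succ, Pi.add_apply, map_add]

theorem superd_smul (c : ℝ) (α : Superform m M 𝔤 E) : superd (c • α) = c • superd α := by
  funext n
  cases n with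
  | zero => exact (smul_zero c).symm
  | succ p => rw [Pi.smul_apply, superd_succ, superd_succ, Pi.smul_apply, map_smul]

/-- The exterior derivative is a derivation of total degree one of the bracket of superforms. -/
theorem superd_dotBracket {α : Superform m M 𝔤 E} (hα : α ∈ TotDeg m M 𝔤 E k)
    (β : Superform m M 𝔤 E) :
    superd (dotBracket α β) =
      dotBracket (superd α) β + (-1 : ℝ) ^ k • dotBracket α (superd β) := by
  funext n
  rw [Pi.add_apply, Pi.smul_apply]
  cases n with
  | zero =>
    rw [superd_zero, dotBracket_apply (superd_mem hα) β (N := 1) (N' := 1) one_pos one_pos,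
      dotBracket_apply hα (superd β) (N := 1) (N' := 1) one_pos one_pos]
    simp [superd_zero]
  | succ n =>
    rw [superd_succ, dotBracket_apply hα β (N := n + 2) (N' := n + 2) (by omega) (by omega),
      dotBracket_apply (superd_mem hα) β (N := n + 3) (N' := n + 2) (by omega) (by omega),
      dotBracket_apply hα (superd β) (N := n + 2) (N' := n + 3) (by omega) (by omega),
      Finset.sum_range_succ' (n := n + 2)]
    simp only [superd_zero, map_zero, LinearMap.zero_apply, smul_zero, Finset.sum_const_zero,
      add_zero, map_sum, Finset.smul_sum, map_smul, superd_succ]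
    rw [← Finset.sum_add_distrib]
    refine Finset.sum_congr rfl fun i _ => ?_
    rw [Finset.sum_range_succ' (n := n + 2)]
    simp only [superd_zero, map_zero, smul_zero, add_zero, superd_succ]
    rw [← Finset.sum_add_distrib]
    refine Finset.sum_congr rfl fun j _ => ?_
    rw [sd_brk, smul_add, smul_smul, smul_smul, neg_one_zpow_add, neg_one_zpow_add]
    congr 2
    · refine neg_one_zpow_congr ⟨(k - i) * j, ?_⟩
      push_cast
      ring
    · refine neg_one_zpow_congr ⟨(k - i) * j + k, ?_⟩
      push_cast
      ring

variable [T2Space M] [CompactSpace M] (κ : LinearMap.BilinForm ℝ 𝔤)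

/-- The pairing as a sum over independent form degrees; only the degrees with sum `m` contribute. -/
theorem superPairInt_apply {α : Superform m M 𝔤 E} (hα : α ∈ TotDeg m M 𝔤 E k)
    (β : Superform m M 𝔤 E) {N N' : ℕ} (hN : m < N) (hN' : m < N') :
    superPairInt κ α β = ∑ i ∈ Finset.range N, ∑ j ∈ Finset.range N',
      (-1 : ℝ) ^ ((k - i) * j) • pairInt κ (α i) (β j) := by
  have h1 : ∀ i ∈ Finset.range (m + 1), ∑ j ∈ Finset.range N',
      (-1 : ℝ) ^ ((k - i) * j) • pairInt κ (α i) (β j) =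
      pairInt κ (SForm.sign (m - i) (α i)) (β (m - i)) := by
    intro i hi
    rw [Finset.mem_range] at hi
    rw [Finset.sum_eq_single (m - i)]
    · rw [SForm.sign_of_mem (m - i) (component_mem hα i), map_smul, LinearMap.smul_apply]
    · intro j _ hj
      rw [pairInt_of_ne κ (by omega : i + j ≠ m), smul_zero]
    · intro h
      exact absurd (Finset.mem_range.2 (by omega)) h
  have h2 : ∑ i ∈ Finset.range (m + 1), ∑ j ∈ Finset.range N',
      (-1 : ℝ) ^ ((k - i) * j) • pairInt κ (α i) (β j) = ∑ i ∈ Finset.range N,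
      ∑ j ∈ Finset.range N', (-1 : ℝ) ^ ((k - i) * j) • pairInt κ (α i) (β j) := by
    refine Finset.sum_subset (Finset.range_subset_range.2 hN) fun i _ hi => ?_
    rw [Finset.mem_range, not_lt] at hi
    refine Finset.sum_eq_zero fun j _ => ?_
    rw [pairInt_of_ne κ (by omega : i + j ≠ m), smul_zero]
  rw [← h2, Finset.sum_congr rfl h1, superPairInt]

theorem superPairInt_add_left (α α' β : Superform m M 𝔤 E) :
    superPairInt κ (α + α') β = superPairInt κ α β + superPairInt κ α' β := by
  simp only [superPairInt, Pi.add_apply, map_add, LinearMap.add_apply, Finset.sum_add_distrib]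

theorem superPairInt_add_right (α β β' : Superform m M 𝔤 E) :
    superPairInt κ α (β + β') = superPairInt κ α β + superPairInt κ α β' := by
  simp only [superPairInt, Pi.add_apply, map_add, Finset.sum_add_distrib]

theorem superPairInt_smul_left (c : ℝ) (α β : Superform m M 𝔤 E) :
    superPairInt κ (c • α) β = c • superPairInt κ α β := by
  simp only [superPairInt, Pi.smul_apply, map_smul, LinearMap.smul_apply, Finset.smul_sum]

theorem superPairInt_smul_right (c : ℝ) (α β : Superform m M 𝔤 E) :
    superPairInt κ α (c • β) = c • superPairInt κ α β := by
  simp only [superPairInt, Pi.smul_apply, map_smul, Finset.smul_sum]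

theorem superPairInt_comm (hκ : κ.IsSymm) {α β : Superform m M 𝔤 E} (hα : α ∈ TotDeg m M 𝔤 E k)
    (hβ : β ∈ TotDeg m M 𝔤 E l) :
    superPairInt κ α β = (-1 : ℝ) ^ (k * l) • superPairInt κ β α := by
  rw [superPairInt_apply κ hα β (Nat.lt_succ_self m) (Nat.lt_succ_self m),
    superPairInt_apply κ hβ α (Nat.lt_succ_self m) (Nat.lt_succ_self m), Finset.sum_comm,
    Finset.smul_sum]
  refine Finset.sum_congr rfl fun j _ => ?_
  rw [Finset.smul_sum]
  refine Finset.sum_congr rfl fun i _ => ?_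
  rw [pairInt_comm κ hκ (component_mem hα i) (component_mem hβ j), smul_smul, smul_smul,
    neg_one_zpow_add, neg_one_zpow_add]
  congr 1
  exact neg_one_zpow_congr ⟨k * l, by ring⟩

/-- Invariance of the pairing of superforms under the bracket. -/
theorem superPairInt_dotBracket (hinv : κ.lieInvariant 𝔤) {α β : Superform m M 𝔤 E}
    (hα : α ∈ TotDeg m M 𝔤 E k) (hβ : β ∈ TotDeg m M 𝔤 E l) (γ : Superform m M 𝔤 E) :
    superPairInt κ (dotBracket α β) γ = superPairInt κ α (dotBracket β γ) := by
  have hN := Nat.lt_succ_self m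
  have hL : superPairInt κ (dotBracket α β) γ =
      ∑ i ∈ Finset.range m.succ, ∑ j ∈ Finset.range m.succ, ∑ t ∈ Finset.range m.succ,
        ((-1 : ℝ) ^ ((k + l - (i + j : ℕ)) * t) * (-1 : ℝ) ^ ((k - i) * j)) •
          pairInt κ (brk m M 𝔤 E i j (i + j) (α i) (β j)) (γ t) := by
    rw [superPairInt_apply κ (dotBracket_mem hα hβ) _ hN hN,
      Finset.sum_comm, Finset.sum_congr rfl fun i _ => Finset.sum_comm]
    refine Eq.trans (Finset.sum_congr rfl fun t _ => ?_) Finset.sum_comm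
    refine (sum_apply_dotBracket (fun s => (pairInt κ).flip (γ t)) (fun s hs => ?_)
        (fun s => (-1 : ℝ) ^ ((k + l - s) * t)) hα β).trans ?_
    · exact LinearMap.ext fun x => pairInt_of_ne κ (by omega) _ _
    · rfl
  have hR : superPairInt κ α (dotBracket β γ) =
      ∑ i ∈ Finset.range m.succ, ∑ j ∈ Finset.range m.succ, ∑ t ∈ Finset.range m.succ,
        ((-1 : ℝ) ^ ((k - i) * (j + t : ℕ)) * (-1 : ℝ) ^ ((l - j) * t)) •
          pairInt κ (α i) (brk m M 𝔤 E j t (j + t) (β j) (γ t)) := by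
    rw [superPairInt_apply κ hα _ hN hN]
    refine Finset.sum_congr rfl fun i _ => ?_
    refine sum_apply_dotBracket (fun s => pairInt κ (α i)) (fun s hs => ?_)
        (fun s => (-1 : ℝ) ^ ((k - i) * s)) hβ γ
    exact LinearMap.ext fun x => pairInt_of_ne κ (by omega) _ _
  rw [hL, hR]
  refine Finset.sum_congr rfl fun i _ => Finset.sum_congr rfl fun j _ =>
    Finset.sum_congr rfl fun t _ => ?_
  rw [pairInt_brk κ hinv, neg_one_zpow_add, neg_one_zpow_add]
  congr 1
  refine neg_one_zpow_congr ⟨(k - i) * j + (k + l - i - j) * t, ?_⟩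
  push_cast
  ring

/-- Integration by parts for superforms. -/
theorem superPairInt_superd (hor : OrientedAtlas m M) {α : Superform m M 𝔤 E}
    (hα : α ∈ TotDeg m M 𝔤 E k) (β : Superform m M 𝔤 E) :
    superPairInt κ (superd α) β + (-1 : ℝ) ^ k • superPairInt κ α (superd β) = 0 := by
  rw [superPairInt_apply κ (superd_mem hα) β (N := m + 2) (N' := m + 1) (by omega) (by omega),
    superPairInt_apply κ hα (superd β) (N := m + 1) (N' := m + 2) (by omega) (by omega),
    Finset.sum_range_succ' (n := m + 1)]
  simp only [superd_zero, map_zero, LinearMap.zero_apply, smul_zero, Finset.sum_const_zero,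
    add_zero, Finset.smul_sum, superd_succ]
  rw [← Finset.sum_add_distrib]
  refine Finset.sum_eq_zero fun i _ => ?_
  rw [Finset.sum_range_succ' (n := m + 1)]
  simp only [superd_zero, map_zero, smul_zero, add_zero, superd_succ]
  rw [← Finset.sum_add_distrib]
  refine Finset.sum_eq_zero fun j _ => ?_
  have h := congrArg (fun x => (-1 : ℝ) ^ ((k - i) * j) • x) (pairInt_sd κ hor (α i) (β j))
  simp only [smul_add, smul_zero, smul_smul, neg_one_zpow_add] at h
  rw [← h, smul_smul, neg_one_zpow_add]
  congr 2
  · refine neg_one_zpow_congr ⟨(k - i) * j, ?_⟩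
    push_cast
    ring
  · refine neg_one_zpow_congr ⟨(k - i) * j + k, ?_⟩
    push_cast
    ring

end SuperIntegral

/-! ### The supercurvature and the Bianchi identity -/

section BF

variable {m : ℕ} {M : Type v} [TopologicalSpace M] [ChartedSpace (Model m) M]
variable {𝔤 : Type w} [LieRing 𝔤] [LieAlgebra ℝ 𝔤] {E : SuperAlg.{u}}

theorem connectionForm_mem (E : SuperAlg.{u}) (A₀ : DForm m M 1 ⊗[ℝ] 𝔤) :
    connectionForm E A₀ ∈ TotDeg m M 𝔤 E 1 := by
  refine mem_TotDeg fun p => ?_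
  by_cases hp : p = 1
  · subst hp
    rw [connectionForm, Pi.single_eq_same]
    induction A₀ using TensorProduct.induction_on with
    | zero => rw [map_zero]; exact Submodule.zero_mem _
    | add _ _ h1 h2 => rw [map_add]; exact Submodule.add_mem _ h1 h2
    | tmul μ x => exact tmul_mem_ghostPart μ x (by simpa using SetLike.one_mem_graded E.gr)
  · rw [connectionForm, Pi.single_eq_of_ne hp]
    exact Submodule.zero_mem _

theorem bracket_ofClassical {p q n : ℕ} (h : p + q = n) (α : DForm m M p ⊗[ℝ] 𝔤)
    (β : DForm m M q ⊗[ℝ] 𝔤) :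
    SForm.bracket h (ofClassical E p α) (ofClassical E q β) =
      ofClassical E n (classicalBracket h α β) := by
  induction α using TensorProduct.induction_on with
  | zero => simp
  | add _ _ h1 h2 => simp only [map_add, LinearMap.add_apply, h1, h2]
  | tmul μ x =>
    induction β using TensorProduct.induction_on with
    | zero => simp
    | add _ _ h1 h2 => simp only [map_add, h1, h2]
    | tmul ν y =>
      change wedge h μ ν ⊗ₜ[ℝ] (⁅x, y⁆ ⊗ₜ[ℝ] ((1 : E) * 1)) = wedge h μ ν ⊗ₜ[ℝ] (⁅x, y⁆ ⊗ₜ[ℝ] (1 : E))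
      rw [one_mul]

/-- The superconnection `A = A₀ + a`. -/
def superConnection (A₀ : DForm m M 1 ⊗[ℝ] 𝔤) (a : Superform m M 𝔤 E) : Superform m M 𝔤 E :=
  connectionForm E A₀ + a

theorem superConnection_mem (A₀ : DForm m M 1 ⊗[ℝ] 𝔤) {a : Superform m M 𝔤 E}
    (ha : a ∈ TotDeg m M 𝔤 E 1) : superConnection A₀ a ∈ TotDeg m M 𝔤 E 1 :=
  Submodule.add_mem _ (connectionForm_mem E A₀) ha

theorem dotBracket_comm_one {α β : Superform m M 𝔤 E} (hα : α ∈ TotDeg m M 𝔤 E 1)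
    (hβ : β ∈ TotDeg m M 𝔤 E 1) : dotBracket α β = dotBracket β α := by
  rw [dotBracket_comm hα hβ, Even.neg_one_zpow (by decide), one_smul]

/-- Stated for additive monoids, the structure that tensor products carry by construction, so that it
applies to superforms without a comparison of instances. -/
theorem eq_zero_of_eq_smul {X : Type*} [AddCommMonoid X] [Module ℝ X] {x : X}
    (h : x = (-1 + -1 : ℝ) • x) : x = 0 := by
  have h1 : x + (2 : ℝ) • x = 0 := by
    nth_rewrite 1 [h]
    rw [← add_smul]
    norm_num
  calc x = (1 / 3 : ℝ) • (x + (2 : ℝ) • x) := by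
        nth_rewrite 2 [← one_smul ℝ x]
        rw [← add_smul, smul_smul]
        norm_num
    _ = 0 := by rw [h1, smul_zero]

/-- For a form of total degree one `⟦A; ⟦A; A⟧⟧ = 0`. -/
theorem dotBracket_self_self {A : Superform m M 𝔤 E} (hA : A ∈ TotDeg m M 𝔤 E 1) :
    dotBracket A (dotBracket A A) = 0 := by
  have h1 := dotBracket_leibniz hA hA A
  rw [dotBracket_comm (dotBracket_mem hA hA) hA, ← add_smul, Odd.neg_one_zpow (by decide),
    Odd.neg_one_zpow (by decide)] at h1
  exact eq_zero_of_eq_smul h1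

theorem Superform.map_add {E' : SuperAlg.{u}} (f : E.Hom E') (α β : Superform m M 𝔤 E) :
    Superform.map f (α + β) = Superform.map f α + Superform.map f β :=
  funext fun p => _root_.map_add (SForm.map f p) (α p) (β p)

variable [IsManifold (𝓡 m) ∞ M]

theorem sd_ofClassical {p : ℕ} (α : DForm m M p ⊗[ℝ] 𝔤) :
    sd m M 𝔤 E p (ofClassical E p α) = ofClassical E (p + 1) (LinearMap.rTensor 𝔤 (extd p) α) := by
  induction α using TensorProduct.induction_on with
  | zero => simp
  | add _ _ h1 h2 => simp only [map_add, h1, h2]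
  | tmul μ x => rfl

/-- The flatness of `A₀`, as an identity between superforms. -/
theorem IsFlat.superd_add {A₀ : DForm m M 1 ⊗[ℝ] 𝔤} (h : IsFlat A₀) (E : SuperAlg.{u}) :
    superd (connectionForm E A₀) +
      (1 / 2 : ℝ) • dotBracket (connectionForm E A₀) (connectionForm E A₀) = 0 := by
  have hdot : ∀ n, dotBracket (connectionForm E A₀) (connectionForm E A₀) n =
      brk m M 𝔤 E 1 1 n (ofClassical E 1 A₀) (ofClassical E 1 A₀) := by
    intro n
    rw [dotBracket_apply (connectionForm_mem E A₀) _ (N := n + 2) (N' := n + 2) (by omega)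
      (by omega), Finset.sum_eq_single 1, Finset.sum_eq_single 1]
    · simp [connectionForm]
    · intro j _ hj
      simp [connectionForm, Pi.single_eq_of_ne hj]
    · intro h; simp at h
    · intro j _ hj
      simp [connectionForm, Pi.single_eq_of_ne hj]
    · intro h; simp at h
  funext n
  rw [Pi.add_apply, Pi.smul_apply, hdot]
  by_cases hn : n = 2
  · subst hn
    rw [superd_succ, brk_of_eq (rfl : 1 + 1 = 2), bracket_ofClassical, connectionForm,
      Pi.single_eq_same, sd_ofClassical, ← map_smul, ← map_add, h, map_zero]
    rfl
  · rw [brk_of_ne (by omega : 1 + 1 ≠ n)]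
    cases n with
    | zero => simp [superd_zero]
    | succ n =>
      rw [superd_succ, connectionForm, Pi.single_eq_of_ne (by omega : n ≠ 1)]
      simp

theorem add_half_smul_eq {X : Type*} [AddCommMonoid X] [Module ℝ X] {dc da cc ca aa : X}
    (h : dc + (1 / 2 : ℝ) • cc = 0) :
    da + ca + (1 / 2 : ℝ) • aa = dc + da + (1 / 2 : ℝ) • (cc + ca + (ca + aa)) := by
  calc da + ca + (1 / 2 : ℝ) • aa =
        dc + (1 / 2 : ℝ) • cc + (da + ca + (1 / 2 : ℝ) • aa) := by rw [h, zero_add]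
    _ = _ := by module

/-- For flat `A₀` the supercurvature is `F_A = dA + ½ ⟦A; A⟧` in terms of `A = A₀ + a`. -/
theorem superCurvature_eq {A₀ : DForm m M 1 ⊗[ℝ] 𝔤} (hflat : IsFlat A₀) {a : Superform m M 𝔤 E}
    (ha : a ∈ TotDeg m M 𝔤 E 1) :
    superCurvature A₀ a = superd (superConnection A₀ a) +
      (1 / 2 : ℝ) • dotBracket (superConnection A₀ a) (superConnection A₀ a) := by
  have h1 := hflat.superd_add E
  have h2 := dotBracket_comm_one ha (connectionForm_mem E A₀)
  rw [superConnection, BFTheory.superd_add, dotBracket_add_left, dotBracket_add_right,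
    dotBracket_add_right, h2]
  exact add_half_smul_eq h1

theorem superCurvature_mem (A₀ : DForm m M 1 ⊗[ℝ] 𝔤) {a : Superform m M 𝔤 E}
    (ha : a ∈ TotDeg m M 𝔤 E 1) : superCurvature A₀ a ∈ TotDeg m M 𝔤 E 2 := by
  have h1 := superd_mem ha
  have h2 := dotBracket_mem (connectionForm_mem E A₀) ha
  have h3 := dotBracket_mem ha ha
  rw [one_add_one_eq_two] at h1 h2 h3
  exact Submodule.add_mem _ (Submodule.add_mem _ h1 h2) (Submodule.smul_mem _ _ h3)

/-- The Bianchi identity `d_A F_A = 0`. -/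
theorem bianchi {A₀ : DForm m M 1 ⊗[ℝ] 𝔤} (hflat : IsFlat A₀) {a : Superform m M 𝔤 E}
    (ha : a ∈ TotDeg m M 𝔤 E 1) :
    superd (superCurvature A₀ a) + dotBracket (superConnection A₀ a) (superCurvature A₀ a) = 0 := by
  have hA := superConnection_mem A₀ ha
  rw [superCurvature_eq hflat ha]
  set A := superConnection A₀ a
  rw [superd_add, superd_smul, superd_superd, superd_dotBracket hA, dotBracket_add_right,
    dotBracket_smul_right, dotBracket_self_self hA, dotBracket_comm (superd_mem hA) hA, ← add_smul,
    smul_zero, zero_add, add_zero, smul_smul]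
  nth_rewrite 2 [← one_smul ℝ (dotBracket A (superd A))]
  rw [← add_smul, Odd.neg_one_zpow (by decide), Odd.neg_one_zpow (by decide)]
  norm_num

/-- The covariant derivative `d_A B` for the superconnection `A = A₀ + a`. -/
def superCovd (A₀ : DForm m M 1 ⊗[ℝ] 𝔤) (a b : Superform m M 𝔤 E) : Superform m M 𝔤 E :=
  superd b + dotBracket (superConnection A₀ a) b

theorem superCovd_mem (A₀ : DForm m M 1 ⊗[ℝ] 𝔤) {a b : Superform m M 𝔤 E} {k : ℤ}
    (ha : a ∈ TotDeg m M 𝔤 E 1) (hb : b ∈ TotDeg m M 𝔤 E k) :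
    superCovd A₀ a b ∈ TotDeg m M 𝔤 E (k + 1) := by
  have := dotBracket_mem (superConnection_mem A₀ ha) hb
  rw [add_comm 1 k] at this
  exact Submodule.add_mem _ (superd_mem hb) this

theorem Superform.map_superCovd {E' : SuperAlg.{u}} (f : E.Hom E') (A₀ : DForm m M 1 ⊗[ℝ] 𝔤)
    (a b : Superform m M 𝔤 E) :
    superCovd A₀ (Superform.map f a) (Superform.map f b) = Superform.map f (superCovd A₀ a b) := by
  simp only [superCovd, superConnection, Superform.map_superd, ← Superform.map_connectionForm f A₀,
    ← Superform.map_add, Superform.map_dotBracket]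

/-- The supercurvature is quadratic in `a`, with linear part `d_A`. -/
theorem superCurvature_add_smul (A₀ : DForm m M 1 ⊗[ℝ] 𝔤) {a ρ : Superform m M 𝔤 E}
    (ha : a ∈ TotDeg m M 𝔤 E 1) (hρ : ρ ∈ TotDeg m M 𝔤 E 1) (t : ℝ) :
    superCurvature A₀ (a + t • ρ) = superCurvature A₀ a + t • superCovd A₀ a ρ +
      t ^ 2 • ((1 / 2 : ℝ) • dotBracket ρ ρ) := by
  have h2 := dotBracket_comm_one hρ ha
  simp only [superCurvature, covd, superCovd, superConnection, superd_add, superd_smul,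
    dotBracket_add_left, dotBracket_add_right, dotBracket_smul_left, dotBracket_smul_right, h2]
  module

/-! ### The functional derivatives of the action and the super BV antibracket -/

variable [T2Space M] [CompactSpace M] (κ : LinearMap.BilinForm ℝ 𝔤)

/-- The covariant derivative is skew-adjoint: `∫ ⟪d_A α; β⟫ + (-1)^|α| ∫ ⟪α; d_A β⟫ = 0`. -/
theorem superPairInt_superCovd (hor : OrientedAtlas m M) (hinv : κ.lieInvariant 𝔤)
    (A₀ : DForm m M 1 ⊗[ℝ] 𝔤) {a α β : Superform m M 𝔤 E} {k : ℤ}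
    (ha : a ∈ TotDeg m M 𝔤 E 1) (hα : α ∈ TotDeg m M 𝔤 E k) :
    superPairInt κ (superCovd A₀ a α) β + (-1 : ℝ) ^ k • superPairInt κ α (superCovd A₀ a β) = 0 := by
  have hA := superConnection_mem A₀ ha
  simp only [superCovd, superPairInt_add_left, superPairInt_add_right]
  rw [← superPairInt_dotBracket κ hinv hα hA, dotBracket_comm hA hα, superPairInt_smul_left,
    smul_add]
  have h := superPairInt_superd κ hor hα β
  rw [add_add_add_comm, h, zero_add, ← add_smul, mul_comm, ← neg_one_zpow_add, mul_one]
  simp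

theorem hasDerivAtZero_of_quadratic {X : Type*} [AddCommGroup X] [Module ℝ X] {f : ℝ → X}
    {x v y : X} (hf : ∀ t, f t = x + t • v + (t ^ 2) • y) : HasDerivAtZero f v := by
  intro l
  have h1 : (fun t => l (f t)) = fun t : ℝ => l x + t * l v + t ^ 2 * l y := by
    funext t
    simp [hf]
  have h2 : HasDerivAt (fun t : ℝ => l x + t * l v + t ^ 2 * l y) (1 * l v + 2 * (0 : ℝ) * l y) 0 := by
    have h3 := ((hasDerivAt_id (0 : ℝ)).mul_const (l v)).const_add (l x)
    have h4 := (hasDerivAt_pow 2 (0 : ℝ)).mul_const (l y)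
    simpa using h3.fun_add h4
  rw [h1]
  simpa using h2

variable (A₀ : DForm m M 1 ⊗[ℝ] 𝔤)

/-- The functional `(a, B) ↦ F_A`, which is the functional derivative of the action with respect
to `B`. -/
def curvatureFunctional : FormFunctional.{u} m M 𝔤 where
  toFun _ a _ := superCurvature A₀ a.1
  natural E E' f a b a' b' ha _ := by rw [ha, Superform.map_superCurvature]

/-- The functional `(a, B) ↦ c d_A B`. For suitable signs `c` it is the left and the right
functional derivative of the action with respect to `a`. -/
def covdFunctional (c : ℝ) : FormFunctional.{u} m M 𝔤 where
  toFun _ a b := c • superCovd A₀ a.1 b.1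
  natural E E' f a b a' b' ha hb := by
    rw [ha, hb, Superform.map_superCovd]
    funext p
    exact (map_smul (SForm.map f p) c _).symm

variable {κ A₀}

/-- The variation of the action with respect to `B`. -/
theorem bfAction_variation_B (E : SuperAlg.{u}) (a : FieldsA m M 𝔤 E) (b ρ : FieldsB m M 𝔤 E) :
    HasDerivAtZero (fun t : ℝ => (bfAction κ A₀).toFun E a (b + t • ρ))
      (superPairInt κ ρ.1 (superCurvature A₀ a.1)) := by
  refine hasDerivAtZero_of_quadratic (x := superPairInt κ b.1 (superCurvature A₀ a.1)) (y := 0)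
    fun t => ?_
  change superPairInt κ (b.1 + t • ρ.1) _ = _
  rw [superPairInt_add_left, superPairInt_smul_left, smul_zero, add_zero]

/-- The variation of the action with respect to `a`. -/
theorem bfAction_variation_A (E : SuperAlg.{u}) (a : FieldsA m M 𝔤 E) (b : FieldsB m M 𝔤 E)
    (ρ : FieldsA m M 𝔤 E) :
    HasDerivAtZero (fun t : ℝ => (bfAction κ A₀).toFun E (a + t • ρ) b)
      (superPairInt κ b.1 (superCovd A₀ a.1 ρ.1)) := by
  refine hasDerivAtZero_of_quadratic (x := superPairInt κ b.1 (superCurvature A₀ a.1))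
    (y := superPairInt κ b.1 ((1 / 2 : ℝ) • dotBracket ρ.1 ρ.1)) fun t => ?_
  change superPairInt κ b.1 (superCurvature A₀ (a.1 + t • ρ.1)) = _
  rw [superCurvature_add_smul A₀ a.2 ρ.2, superPairInt_add_right, superPairInt_add_right,
    superPairInt_smul_right, superPairInt_smul_right κ (t ^ 2)]

theorem hasLeftDerivB_bfAction : HasLeftDerivB κ (bfAction κ A₀) (curvatureFunctional.{u} A₀) :=
  fun E a b ρ => bfAction_variation_B E a b ρ

theorem hasRightDerivB_bfAction (hκ : κ.IsSymm) :
    HasRightDerivB κ (bfAction κ A₀) (curvatureFunctional.{u} A₀) := by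
  intro E a b ρ
  have h := bfAction_variation_B (κ := κ) (A₀ := A₀) E a b ρ
  rwa [superPairInt_comm κ hκ ρ.2 (superCurvature_mem A₀ a.2),
    Even.neg_one_zpow ⟨(m : ℤ) - 2, by ring⟩, one_smul] at h

theorem hasRightDerivA_bfAction (hor : OrientedAtlas m M) (hinv : κ.lieInvariant 𝔤) :
    HasRightDerivA κ (bfAction κ A₀) (covdFunctional.{u} A₀ (-(-1) ^ m)) := by
  intro E a b ρ
  have h := bfAction_variation_A (κ := κ) (A₀ := A₀) E a b ρ
  have h1 := superPairInt_superCovd κ hor hinv A₀ (β := ρ.1) a.2 b.2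
  have hs : (-1 : ℝ) ^ ((m : ℤ) - 2) = (-1) ^ m := by
    rw [← zpow_natCast]
    exact neg_one_zpow_congr ⟨m - 1, by ring⟩
  have h2 : superPairInt κ b.1 (superCovd A₀ a.1 ρ.1) =
      superPairInt κ ((-(-1 : ℝ) ^ m) • superCovd A₀ a.1 b.1) ρ.1 := by
    rw [superPairInt_smul_left, eq_neg_of_add_eq_zero_left h1, hs, smul_neg, neg_smul, neg_neg,
      smul_smul, ← mul_pow, neg_one_mul, neg_neg, one_pow, one_smul]
  rwa [h2] at h

theorem hasLeftDerivA_bfAction (hor : OrientedAtlas m M) (hκ : κ.IsSymm)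
    (hinv : κ.lieInvariant 𝔤) : HasLeftDerivA κ (bfAction κ A₀) (covdFunctional.{u} A₀ 1) := by
  intro E a b ρ
  have h := hasRightDerivA_bfAction (A₀ := A₀) hor hinv E a b ρ
  change HasDerivAtZero _ (superPairInt κ ((-(-1 : ℝ) ^ m) • superCovd A₀ a.1 b.1) ρ.1) at h
  change HasDerivAtZero _ (superPairInt κ ρ.1 ((1 : ℝ) • superCovd A₀ a.1 b.1))
  have hs : -(-1 : ℝ) ^ m * (-1 : ℝ) ^ (((m : ℤ) - 2 + 1) * 1) = 1 := by
    rw [neg_mul, ← zpow_natCast, neg_one_zpow_add, neg_eq_iff_eq_neg]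
    exact Odd.neg_one_zpow ⟨m - 1, by ring⟩
  rw [superPairInt_smul_left, superPairInt_comm κ hκ (superCovd_mem A₀ a.2 b.2) ρ.2, smul_smul,
    hs, one_smul] at h
  rwa [one_smul]

/-- By the Bianchi identity `∫ ⟪F_A; d_A B⟫ = 0`. -/
theorem superPairInt_curvature_covd (hor : OrientedAtlas m M) (hinv : κ.lieInvariant 𝔤)
    (hflat : IsFlat A₀) {a : Superform m M 𝔤 E} (ha : a ∈ TotDeg m M 𝔤 E 1)
    (b : Superform m M 𝔤 E) :
    superPairInt κ (superCurvature A₀ a) (superCovd A₀ a b) = 0 := by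
  have h := superPairInt_superCovd κ hor hinv A₀ (β := b) ha (superCurvature_mem A₀ ha)
  have h0 : superCovd A₀ a (superCurvature A₀ a) = 0 := bianchi hflat ha
  have hz : superPairInt κ (0 : Superform m M 𝔤 E) b = 0 := by
    simp [superPairInt]
  rw [h0, hz, zero_add] at h
  simpa using h

theorem superPairInt_covd_curvature (hor : OrientedAtlas m M) (hκ : κ.IsSymm)
    (hinv : κ.lieInvariant 𝔤) (hflat : IsFlat A₀) {a b : Superform m M 𝔤 E} {k : ℤ}
    (ha : a ∈ TotDeg m M 𝔤 E 1) (hb : b ∈ TotDeg m M 𝔤 E k) :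
    superPairInt κ (superCovd A₀ a b) (superCurvature A₀ a) = 0 := by
  rw [superPairInt_comm κ hκ (superCovd_mem A₀ ha hb) (superCurvature_mem A₀ ha),
    superPairInt_curvature_covd hor hinv hflat ha, smul_zero]

/-- The classical master equation for the super BV antibracket. -/
theorem hasSuperBVBracket_bfAction (hor : OrientedAtlas m M) (hκ : κ.IsSymm)
    (hinv : κ.lieInvariant 𝔤) (hflat : IsFlat A₀) :
    HasSuperBVBracket.{u} κ (bfAction κ A₀) (bfAction κ A₀) 0 := by
  refine ⟨_, _, _, _, hasRightDerivA_bfAction hor hinv, hasRightDerivB_bfAction hκ,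
    hasLeftDerivA_bfAction hor hκ hinv, hasLeftDerivB_bfAction, fun E a b => ?_⟩
  change (0 : E) = superPairInt κ (superCurvature A₀ a.1) ((1 : ℝ) • superCovd A₀ a.1 b.1) -
    (-1 : ℝ) ^ m • superPairInt κ ((-(-1 : ℝ) ^ m) • superCovd A₀ a.1 b.1) (superCurvature A₀ a.1)
  rw [superPairInt_smul_right, superPairInt_smul_left,
    superPairInt_curvature_covd hor hinv hflat a.2,
    superPairInt_covd_curvature hor hκ hinv hflat a.2 b.2]
  simp

end BF

/-! ### Component fields and the ordinary BV antibracket -/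

section Components

variable {m : ℕ} {M : Type v} [TopologicalSpace M] [ChartedSpace (Model m) M]
variable {𝔤 : Type w} [LieRing 𝔤] [LieAlgebra ℝ 𝔤] {E : SuperAlg.{u}}

theorem rescale_add_smul {k : ℤ} (s : ℕ → ℝ) (α β : TotDeg m M 𝔤 E k) (t : ℝ) :
    rescale s (α + t • β) = rescale s α + t • rescale s β := by
  refine Subtype.ext (funext fun p => ?_)
  change s p • (α.1 p + t • β.1 p) = s p • α.1 p + t • s p • β.1 p
  rw [smul_add, smul_comm]

theorem map_rescale {E' : SuperAlg.{u}} {k : ℤ} (f : E.Hom E') (s : ℕ → ℝ)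
    {α : TotDeg m M 𝔤 E k} {α' : TotDeg m M 𝔤 E' k} (h : α'.1 = Superform.map f α.1) :
    (rescale s α').1 = Superform.map f (rescale s α).1 := by
  funext p
  simp [rescale, Superform.map, h]

/-- A superfield derivative `D` of a functional determines the right derivatives with respect to the
component fields, which enter the superfield with the signs `s`. -/
def FormFunctional.componentRight (s : ℕ → ℝ) (D : FormFunctional.{u} m M 𝔤) :
    FormFunctional.{u} m M 𝔤 where
  toFun E a b p := s (m - p) •
    SForm.sign (m - p) (D.toFun E (rescale (sigmaA m) a) (rescale (sigmaB m) b) p)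
  natural E E' f a b a' b' ha hb := by
    funext p
    rw [D.natural E E' f _ _ _ _ (map_rescale f _ ha) (map_rescale f _ hb)]
    simp only [Superform.map, SForm.map_sign, map_smul]

/-- A superfield derivative `D` of a functional determines the left derivatives with respect to the
component fields, which enter the superfield of total degree `k` with the signs `s`. -/
def FormFunctional.componentLeft (k : ℤ) (s : ℕ → ℝ) (D : FormFunctional.{u} m M 𝔤) :
    FormFunctional.{u} m M 𝔤 where
  toFun E a b p := (s (m - p) * (-1 : ℝ) ^ ((k - (m - p : ℕ)) * p)) •
    D.toFun E (rescale (sigmaA m) a) (rescale (sigmaB m) b) p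
  natural E E' f a b a' b' ha hb := by
    funext p
    rw [D.natural E E' f _ _ _ _ (map_rescale f _ ha) (map_rescale f _ hb)]
    simp only [Superform.map, map_smul]

variable [IsManifold (𝓡 m) ∞ M] [T2Space M] [CompactSpace M] {κ : LinearMap.BilinForm ℝ 𝔤}

/-- Pairing with a superform whose only component has degree `j`. -/
theorem superPairInt_of_single_right {j : ℕ} (hj : j ≤ m) (α : Superform m M 𝔤 E)
    {ρ : Superform m M 𝔤 E} (hρ : ∀ i ≠ j, ρ i = 0) :
    superPairInt κ α ρ = pairInt κ (SForm.sign j (α (m - j))) (ρ j) := by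
  rw [superPairInt, Finset.sum_eq_single (m - j)]
  · rw [Nat.sub_sub_self hj]
  · intro p hp hpj
    rw [Finset.mem_range] at hp
    rw [hρ (m - p) (by omega), map_zero]
  · intro h
    exact absurd (Finset.mem_range.2 (by omega)) h

theorem superPairInt_of_single_left {j : ℕ} (hj : j ≤ m) (α : Superform m M 𝔤 E)
    {ρ : Superform m M 𝔤 E} (hρ : ∀ i ≠ j, ρ i = 0) :
    superPairInt κ ρ α = pairInt κ (SForm.sign (m - j) (ρ j)) (α (m - j)) := by
  rw [superPairInt, Finset.sum_eq_single j]
  · intro p _ hpj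
    rw [hρ p hpj, map_zero, map_zero, LinearMap.zero_apply]
  · intro h
    exact absurd (Finset.mem_range.2 (by omega)) h

/-- The sign of the field of degree `j` is written as `s (m - (m - j))`: a derivative with respect to
this field has degree `m - j`, and its sign must depend on this degree alone. -/
theorem superPairInt_rescale_right {k : ℤ} (s : ℕ → ℝ) {j : ℕ} (hj : j ≤ m)
    (α : Superform m M 𝔤 E) {ρ : TotDeg m M 𝔤 E k} (hρ : ∀ i ≠ j, ρ.1 i = 0) :
    superPairInt κ α (rescale s ρ).1 =
      pairInt κ (s (m - (m - j)) • SForm.sign (m - (m - j)) (α (m - j))) (ρ.1 j) := by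
  rw [superPairInt_of_single_right hj α (ρ := (rescale s ρ).1) fun i hi => by
    change s i • ρ.1 i = 0
    rw [hρ i hi, smul_zero], Nat.sub_sub_self hj]
  change pairInt κ _ (s j • ρ.1 j) = _
  rw [map_smul, map_smul, LinearMap.smul_apply]

theorem superPairInt_rescale_left {k : ℤ} (s : ℕ → ℝ) {j : ℕ} (hj : j ≤ m)
    (α : Superform m M 𝔤 E) {ρ : TotDeg m M 𝔤 E k} (hρ : ∀ i ≠ j, ρ.1 i = 0) :
    superPairInt κ (rescale s ρ).1 α =
      pairInt κ (ρ.1 j) ((s (m - (m - j)) * (-1 : ℝ) ^ ((k - (m - (m - j) : ℕ)) * (m - j : ℕ))) •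
        α (m - j)) := by
  rw [superPairInt_of_single_left hj α (ρ := (rescale s ρ).1) fun i hi => by
    change s i • ρ.1 i = 0
    rw [hρ i hi, smul_zero], Nat.sub_sub_self hj]
  change pairInt κ (SForm.sign (m - j) (s j • ρ.1 j)) _ = _
  rw [map_smul, SForm.sign_of_mem (m - j) (component_mem ρ.2 j), map_smul, map_smul, map_smul,
    LinearMap.smul_apply, LinearMap.smul_apply, smul_smul]

variable {F : Functional.{u} m M 𝔤} {D : FormFunctional.{u} m M 𝔤}

theorem HasRightDerivA.inComponents (h : HasRightDerivA κ F D) :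
    HasRightDerivsA κ F.inComponents (D.componentRight (sigmaA m)) := by
  intro E a b j hj ρ hρ
  have h1 := h E (rescale (sigmaA m) a) (rescale (sigmaB m) b) (rescale (sigmaA m) ρ)
  rw [superPairInt_rescale_right _ hj _ hρ] at h1
  simp only [← rescale_add_smul] at h1
  exact h1

theorem HasRightDerivB.inComponents (h : HasRightDerivB κ F D) :
    HasRightDerivsB κ F.inComponents (D.componentRight (sigmaB m)) := by
  intro E a b j hj ρ hρ
  have h1 := h E (rescale (sigmaA m) a) (rescale (sigmaB m) b) (rescale (sigmaB m) ρ)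
  rw [superPairInt_rescale_right _ hj _ hρ] at h1
  simp only [← rescale_add_smul] at h1
  exact h1

theorem HasLeftDerivA.inComponents (h : HasLeftDerivA κ F D) :
    HasLeftDerivsA κ F.inComponents (D.componentLeft 1 (sigmaA m)) := by
  intro E a b j hj ρ hρ
  have h1 := h E (rescale (sigmaA m) a) (rescale (sigmaB m) b) (rescale (sigmaA m) ρ)
  rw [superPairInt_rescale_left _ hj _ hρ] at h1
  simp only [← rescale_add_smul] at h1
  exact h1

theorem HasLeftDerivB.inComponents (h : HasLeftDerivB κ F D) :
    HasLeftDerivsB κ F.inComponents (D.componentLeft ((m : ℤ) - 2) (sigmaB m)) := by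
  intro E a b j hj ρ hρ
  have h1 := h E (rescale (sigmaA m) a) (rescale (sigmaB m) b) (rescale (sigmaB m) ρ)
  rw [superPairInt_rescale_left _ hj _ hρ] at h1
  simp only [← rescale_add_smul] at h1
  exact h1

/-- The product of the signs of the fields `c`, `a` and of their antifields. -/
theorem sigmaA_mul_sigmaB_of_lt {i r : ℕ} (hm : 2 ≤ m) (hi : i < 2) (h : i + r = m) :
    sigmaA m i * sigmaB m r = (-1 : ℝ) ^ (1 + (r : ℤ)) := by
  interval_cases i
  · obtain rfl : r = m := by omega
    simp only [sigmaA, sigmaB, if_true, mul_one]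
    rw [add_comm 1 (r : ℤ)]
    exact_mod_cast (zpow_natCast (-1 : ℝ) (r + 1)).symm
  · rw [sigmaA, sigmaB, if_neg (by omega), if_pos (by omega), one_mul,
      show (1 : ℤ) + r = (m : ℕ) by rw [← h]; push_cast; ring, zpow_natCast]

/-- The product of the signs of the fields `B` (for `k = 0`) and `τ_k`, of degree `r = m - 2 - k`, and
of their antifields, of degree `k + 2`. -/
theorem sigmaA_mul_sigmaB {k r : ℕ} (h : k + 2 + r = m) :
    sigmaA m (k + 2) * sigmaB m r = (-1 : ℝ) ^ ((r : ℤ) * (1 + (k + 2 : ℕ))) := by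
  rw [sigmaA, sigmaB, if_neg (by omega), if_neg (by omega), show m - 2 - r = k by omega, pow_add,
    mul_right_comm, ← mul_pow, neg_one_mul, neg_neg, one_pow, one_mul, ← zpow_natCast]
  refine neg_one_zpow_congr ?_
  have h1 : Even ((k : ℤ) * (k + 1)) := Int.even_mul_succ_self k
  obtain ⟨c, hc⟩ := h1
  refine ⟨c + k + 1 + r * (k + 2), ?_⟩
  rw [← h]
  push_cast
  linear_combination hc

/-- The fields `c`, `a` and the antifields of `B`, `τ_k` have together every form degree from `0` to
`m` once. -/
theorem sum_range_two_add_reflect {X : Type*} [AddCommMonoid X] (hm : 2 ≤ m) (f : ℕ → X) :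
    ∑ j ∈ Finset.range 2, f j + ∑ j ∈ Finset.range (m - 1), f (m - j) =
      ∑ p ∈ Finset.range (m + 1), f p := by
  obtain ⟨n, rfl⟩ := Nat.exists_eq_add_of_le hm
  rw [show 2 + n + 1 = 2 + (n + 1) by omega, Finset.sum_range_add,
    ← Finset.sum_range_reflect _ (n + 1), show 2 + n - 1 = n + 1 by omega]
  congr 1
  refine Finset.sum_congr rfl fun j hj => ?_
  rw [Finset.mem_range] at hj
  congr 1
  omega

end Components

/-! ### The ordinary master equation -/

section MasterEquation

variable {m : ℕ} {M : Type v} [TopologicalSpace M] [ChartedSpace (Model m) M]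
variable {𝔤 : Type w} [LieRing 𝔤] [LieAlgebra ℝ 𝔤]
variable [IsManifold (𝓡 m) ∞ M] [T2Space M] [CompactSpace M] {κ : LinearMap.BilinForm ℝ 𝔤}
variable {A₀ : DForm m M 1 ⊗[ℝ] 𝔤}

/-- The pairing of the derivatives of the action with respect to the fields `a_i` and `B_r`, where
`i + r = m`. -/
theorem pairInt_componentRight_covd (hκ : κ.IsSymm) {i r : ℕ} (h : i + r = m) (E : SuperAlg.{u})
    (a : FieldsA m M 𝔤 E) (b : FieldsB m M 𝔤 E) :
    pairInt κ (((covdFunctional A₀ (-(-1) ^ m)).componentRight (sigmaA m)).toFun E a b r)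
      (((curvatureFunctional A₀).componentLeft ((m : ℤ) - 2) (sigmaB m)).toFun E a b i) =
      (sigmaA m i * sigmaB m r * (-1 : ℝ) ^ (1 + m + i + r * i : ℤ)) •
        pairInt κ (superCurvature A₀ (rescale (sigmaA m) a).1 i)
          (superCovd A₀ (rescale (sigmaA m) a).1 (rescale (sigmaB m) b).1 r) := by
  set F := superCurvature A₀ (rescale (sigmaA m) a).1
  set G := superCovd A₀ (rescale (sigmaA m) a).1 (rescale (sigmaB m) b).1
  have hFi : F i ∈ ghostPart m M 𝔤 E i (2 - i) :=
    component_mem (superCurvature_mem A₀ (rescale (sigmaA m) a).2) i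
  have hGr : G r ∈ ghostPart m M 𝔤 E r ((m : ℤ) - 2 + 1 - r) :=
    component_mem (superCovd_mem A₀ (rescale (sigmaA m) a).2 (rescale (sigmaB m) b).2) r
  have h1 : m - r = i := by omega
  have h2 : m - i = r := by omega
  have hmc : (m : ℤ) = i + r := by rw [← h]; push_cast; ring
  change pairInt κ (sigmaA m (m - r) • SForm.sign (m - r) ((-(-1 : ℝ) ^ m) • G r))
    ((sigmaB m (m - i) * (-1 : ℝ) ^ (((m : ℤ) - 2 - (m - i : ℕ)) * i)) • F i) = _
  rw [h1, h2, map_smul (SForm.sign i), SForm.sign_of_mem i hGr]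
  simp only [map_smul, LinearMap.smul_apply]
  rw [pairInt_comm κ hκ hGr hFi]
  simp only [smul_smul]
  congr 1
  have hs : -(-1 : ℝ) ^ m = (-1 : ℝ) ^ (1 + m : ℤ) := by
    rw [← neg_one_zpow_add, zpow_one, zpow_natCast, neg_one_mul]
  have hexp : (-1 : ℝ) ^ (1 + m : ℤ) * (-1 : ℝ) ^ (((m : ℤ) - 2 + 1 - r) * i) *
      (-1 : ℝ) ^ (((m : ℤ) - 2 - r) * i) *
      (-1 : ℝ) ^ ((r : ℤ) * i + ((m : ℤ) - 2 + 1 - r) * (2 - i)) =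
      (-1 : ℝ) ^ (1 + m + i + r * i : ℤ) := by
    simp only [neg_one_zpow_add]
    obtain ⟨c, hc⟩ := Int.even_mul_succ_self (i : ℤ)
    refine neg_one_zpow_congr ⟨1 + m + r * i + (i - 2) * i + (i - 1) + 2 * i - c, ?_⟩
    rw [hmc]
    linear_combination -hc
  rw [hs, ← hexp]
  ring

/-- The pairing of the derivatives of the action with respect to the fields `B_r` and `a_i`, where
`i + r = m`. -/
theorem pairInt_componentRight_curvature {i r : ℕ} (h : i + r = m) (E : SuperAlg.{u})
    (a : FieldsA m M 𝔤 E) (b : FieldsB m M 𝔤 E) :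
    pairInt κ (((curvatureFunctional A₀).componentRight (sigmaB m)).toFun E a b i)
      (((covdFunctional A₀ 1).componentLeft 1 (sigmaA m)).toFun E a b r) =
      (sigmaA m i * sigmaB m r * (-1 : ℝ) ^ (r : ℤ)) •
        pairInt κ (superCurvature A₀ (rescale (sigmaA m) a).1 i)
          (superCovd A₀ (rescale (sigmaA m) a).1 (rescale (sigmaB m) b).1 r) := by
  set F := superCurvature A₀ (rescale (sigmaA m) a).1
  set G := superCovd A₀ (rescale (sigmaA m) a).1 (rescale (sigmaB m) b).1
  have hFi : F i ∈ ghostPart m M 𝔤 E i (2 - i) :=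
    component_mem (superCurvature_mem A₀ (rescale (sigmaA m) a).2) i
  have h1 : m - r = i := by omega
  have h2 : m - i = r := by omega
  change pairInt κ (sigmaB m (m - i) • SForm.sign (m - i) (F i))
    ((sigmaA m (m - r) * (-1 : ℝ) ^ ((1 - (m - r : ℕ) : ℤ) * r)) • (1 : ℝ) • G r) = _
  rw [h1, h2, SForm.sign_of_mem r hFi, one_smul]
  simp only [map_smul, LinearMap.smul_apply, smul_smul]
  congr 1
  have hexp : (-1 : ℝ) ^ ((2 - i : ℤ) * r) * (-1 : ℝ) ^ ((1 - i : ℤ) * r) = (-1 : ℝ) ^ (r : ℤ) := by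
    rw [neg_one_zpow_add]
    exact neg_one_zpow_congr ⟨(2 - i) * r, by ring⟩
  rw [← hexp]
  ring

/-- The master equation for the ordinary BV antibracket: in components, the antibracket `(S, S)` is
again `2 ∫ ⟪F_A; d_A B⟫`. -/
theorem hasBVBracket_bfAction (hm : 2 ≤ m) (hor : OrientedAtlas m M) (hκ : κ.IsSymm)
    (hinv : κ.lieInvariant 𝔤) (hflat : IsFlat A₀) :
    HasBVBracket.{u} κ (bfAction κ A₀).inComponents (bfAction κ A₀).inComponents 0 := by
  refine ⟨_, _, _, _, (hasRightDerivA_bfAction hor hinv).inComponents,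
    (hasRightDerivB_bfAction hκ).inComponents, (hasLeftDerivA_bfAction hor hκ hinv).inComponents,
    hasLeftDerivB_bfAction.inComponents, fun E a b => ?_⟩
  -- The term of `2 ∫ ⟪F_A; d_A B⟫` in which `F_A` has degree `p`.
  let f : ℕ → E := fun p => (2 : ℝ) • (-1 : ℝ) ^ ((2 - p : ℤ) * (m - p : ℕ)) •
    pairInt κ (superCurvature A₀ (rescale (sigmaA m) a).1 p)
      (superCovd A₀ (rescale (sigmaA m) a).1 (rescale (sigmaB m) b).1 (m - p))
  have hsum : ∑ p ∈ Finset.range (m + 1), f p = 0 := by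
    have h1 := superPairInt_curvature_covd hor hinv hflat (rescale (sigmaA m) a).2
      (rescale (sigmaB m) b).1
    rw [superPairInt] at h1
    rw [← Finset.smul_sum]
    refine (congrArg (fun x : E => (2 : ℝ) • x) (Eq.trans ?_ h1)).trans (smul_zero _)
    refine Finset.sum_congr rfl fun p _ => ?_
    rw [SForm.sign_of_mem (m - p) (component_mem (superCurvature_mem A₀ (rescale (sigmaA m) a).2) p),
      map_smul, LinearMap.smul_apply]
  -- The summands of the antibracket for the fields `c`, `a`, of form degree `j`.
  have hfirst : ∀ j ∈ Finset.range 2,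
      pairInt κ (((covdFunctional A₀ (-(-1) ^ m)).componentRight (sigmaA m)).toFun E a b (m - j))
        (((curvatureFunctional A₀).componentLeft ((m : ℤ) - 2) (sigmaB m)).toFun E a b
          (m - (m - j))) -
      (-1 : ℝ) ^ ((m + 1) * j) •
        pairInt κ (((curvatureFunctional A₀).componentRight (sigmaB m)).toFun E a b (m - (m - j)))
          (((covdFunctional A₀ 1).componentLeft 1 (sigmaA m)).toFun E a b (m - j)) = f j := by
    intro j hj
    rw [Finset.mem_range] at hj
    have hjm : j + (m - j) = m := by omega
    have hmc : (m : ℤ) = j + (m - j : ℕ) := by omega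
    rw [Nat.sub_sub_self (by omega : j ≤ m), pairInt_componentRight_covd hκ hjm,
      pairInt_componentRight_curvature hjm, sigmaA_mul_sigmaB_of_lt hm hj hjm, smul_smul, ← sub_smul,
      neg_one_pow_mul]
    refine Eq.trans ?_ (smul_smul (2 : ℝ) _ _).symm
    refine congrArg (fun x : ℝ => x • _) ?_
    have hX : (-1 : ℝ) ^ (1 + ((m - j : ℕ) : ℤ)) * (-1 : ℝ) ^ (1 + m + j + (m - j : ℕ) * j : ℤ) =
        (-1 : ℝ) ^ ((2 - j : ℤ) * (m - j : ℕ)) := by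
      rw [neg_one_zpow_add, hmc]
      exact neg_one_zpow_congr ⟨1 + 2 * (m - j : ℕ) + j, by ring⟩
    have hY : (-1 : ℝ) ^ (((m + 1 : ℕ) : ℤ) * j) *
        ((-1 : ℝ) ^ (1 + ((m - j : ℕ) : ℤ)) * (-1 : ℝ) ^ ((m - j : ℕ) : ℤ)) =
        (-1 : ℝ) ^ (1 + (2 - j : ℤ) * (m - j : ℕ)) := by
      obtain ⟨c, hc⟩ := Int.even_mul_succ_self (j : ℤ)
      rw [neg_one_zpow_add, neg_one_zpow_add]
      refine neg_one_zpow_congr ⟨c + 1 + 2 * (m - j : ℕ), ?_⟩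
      rw [Nat.cast_add, hmc]
      push_cast
      linear_combination hc
    rw [hX, hY, ← neg_one_zpow_add, zpow_one]
    ring
  -- The summands for the fields `B`, `τ_k`, of form degree `j`; here `F_A` has degree `m - j`.
  have hsecond : ∀ j ∈ Finset.range (m - 1),
      pairInt κ (((curvatureFunctional A₀).componentRight (sigmaB m)).toFun E a b (m - j))
          (((covdFunctional A₀ 1).componentLeft 1 (sigmaA m)).toFun E a b (m - (m - j))) -
      (-1 : ℝ) ^ ((m + 1) * j) •
        pairInt κ (((covdFunctional A₀ (-(-1) ^ m)).componentRight (sigmaA m)).toFun E a b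
          (m - (m - j)))
        (((curvatureFunctional A₀).componentLeft ((m : ℤ) - 2) (sigmaB m)).toFun E a b (m - j)) =
      f (m - j) := by
    intro j hj
    rw [Finset.mem_range] at hj
    obtain ⟨k, hk⟩ : ∃ k, m - j = k + 2 := ⟨m - j - 2, by omega⟩
    have hjm : k + 2 + j = m := by omega
    have hmc : (m : ℤ) = (k + 2 : ℕ) + j := by omega
    have hf : f (m - j) = (2 : ℝ) • (-1 : ℝ) ^ ((2 - (k + 2 : ℕ) : ℤ) * j) •
        pairInt κ (superCurvature A₀ (rescale (sigmaA m) a).1 (k + 2))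
          (superCovd A₀ (rescale (sigmaA m) a).1 (rescale (sigmaB m) b).1 j) := by
      change (2 : ℝ) • (-1 : ℝ) ^ ((2 - (m - j : ℕ) : ℤ) * (m - (m - j) : ℕ)) • _ = _
      rw [Nat.sub_sub_self (by omega : j ≤ m), hk]
    rw [hf, Nat.sub_sub_self (by omega : j ≤ m), hk, pairInt_componentRight_covd hκ hjm,
      pairInt_componentRight_curvature hjm, sigmaA_mul_sigmaB hjm, smul_smul, ← sub_smul,
      neg_one_pow_mul, smul_smul]
    refine congrArg (fun x : ℝ => x • _) ?_
    have hX : (-1 : ℝ) ^ ((j : ℤ) * (1 + (k + 2 : ℕ))) * (-1 : ℝ) ^ (j : ℤ) =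
        (-1 : ℝ) ^ ((2 - (k + 2 : ℕ) : ℤ) * j) := by
      rw [neg_one_zpow_add]
      exact neg_one_zpow_congr ⟨2 * j, by ring⟩
    have hY : (-1 : ℝ) ^ (((m + 1 : ℕ) : ℤ) * j) * ((-1 : ℝ) ^ ((j : ℤ) * (1 + (k + 2 : ℕ))) *
        (-1 : ℝ) ^ (1 + m + (k + 2 : ℕ) + j * (k + 2 : ℕ) : ℤ)) =
        (-1 : ℝ) ^ (1 + (2 - (k + 2 : ℕ) : ℤ) * j) := by
      obtain ⟨c, hc⟩ := Int.even_mul_succ_self (j : ℤ)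
      rw [neg_one_zpow_add, neg_one_zpow_add]
      refine neg_one_zpow_congr ⟨c + 2 * j + (k + 2 : ℕ) * j + 1 + (k + 2 : ℕ), ?_⟩
      rw [Nat.cast_add m 1, hmc]
      push_cast
      linear_combination hc
    rw [hX, hY, ← neg_one_zpow_add, zpow_one]
    ring
  change (0 : E) = _
  rw [← hsum, ← sum_range_two_add_reflect hm f]
  exact congrArg₂ (· + ·) (Finset.sum_congr rfl fun j hj => (hfirst j hj).symm)
    (Finset.sum_congr rfl fun j hj => (hsecond j hj).symm)

end MasterEquation

end BFTheory

end

theorem theorem6p1 {m : ℕ} (hm : 2 ≤ m)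
    {M : Type v} [TopologicalSpace M] [T2Space M] [CompactSpace M]
    [ChartedSpace (EuclideanSpace ℝ (Fin m)) M] [IsManifold (𝓡 m) ∞ M]
    (horiented : BFTheory.OrientedAtlas m M)
    {𝔤 : Type w} [LieRing 𝔤] [LieAlgebra ℝ 𝔤] [FiniteDimensional ℝ 𝔤]
    (κ : LinearMap.BilinForm ℝ 𝔤) (hsymm : κ.IsSymm) (hinv : κ.lieInvariant 𝔤)
    (hnondeg : κ.Nondegenerate)
    (A₀ : BFTheory.DForm m M 1 ⊗[ℝ] 𝔤) (hflat : BFTheory.IsFlat A₀) :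
    BFTheory.HasSuperBVBracket.{u} κ (BFTheory.bfAction κ A₀) (BFTheory.bfAction κ A₀) 0 ∧
    BFTheory.HasBVBracket.{u} κ (BFTheory.bfAction κ A₀).inComponents
      (BFTheory.bfAction κ A₀).inComponents 0 :=
  ⟨BFTheory.hasSuperBVBracket_bfAction horiented hsymm hinv hflat,
    BFTheory.hasBVBracket_bfAction hm horiented hsymm hinv hflat⟩
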